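/- **Setting.** Let $\mathcal X\subset\mathbb R^d$ with its Borel $\sigma$-algebra and let $(\rho_t)_{t\ge 0}$ be the transition semigroup of a time-homogeneous Markov process on $\mathcal X$ (Markov kernels with $\rho_0(x,\cdot)=\delta_x$ and $\rho_{s+t}(x,A)=\int\rho_t(y,A)\,\rho_s(x,dy)$), for instance that of the solution of an SDE $dX_t=b(X_t)\,dt+\sigma(X_t)\,dW_t$. Let $\mu$ be an invariant probability measure, $\int\rho_t(x,A)\,d\mu(x)=\mu(A)$ for all $t\ge0$. The Koopman operator $K^t$ is the contraction $(K^t\psi)(x)=\int\psi(y)\,\rho_t(x,dy)$ on the real space $L^2_\mu(\mathcal X)$, whose scalar product is $\langle\cdot,\cdot\rangle_\mu$; $Q$ is the orthogonal projection onto $\mathbb 1^\perp$ and $K_0^t$ is the restriction of $K^t$ to $\mathbb 1^\perp$. Let $k:\mathcal X\times\mathcal X\to\mathbb R$ be a continuous symmetric positive semidefinite kernel with reproducing kernel Hilbert space $\mathbb H$ (norm $\|\cdot\|$), feature map $\Phi(x)=k(x,\cdot)$ and diagonal $\varphi(x)=k(x,x)$. Assume - (A1) $\varphi\in L^2_\mu$;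 - (A2) if $\psi\in L^2_\mu$ and $\iint k(x,y)\psi(x)\psi(y)\,d\mu(x)\,d\mu(y)=0$, then $\psi=0$; - (A3) if $\psi\in\mathbb H$ vanishes $\mu$-a.e., then $\psi=0$ everywhere. Put $\mathcal E\psi=\int\psi(x)\Phi(x)\,d\mu(x)$ for $\psi\in L^2_\mu$ (so that $\mathcal E^*$ is the inclusion $\mathbb H\to L^2_\mu$), $C_{xy}\psi=\psi(y)\Phi(x)$ for $\psi\in\mathbb H$, and $C^t_{\mathbb H}=\mathcal EK^t\mathcal E^*$. For data $(x_k,y_k)$, $k=0,\dots,m-1$, put $\widehat C^{m,t}_{\mathbb H}=\frac1m\sum_{k=0}^{m-1}C_{x_k,y_k}$. Fix $t>0$, an integer $m\ge1$ and $\varepsilon>0$, and consider two sampling schemes. - **Case (1), i.i.d. data.** The pairs $(x_k,y_k)$ are independent, $x_k\sim\mu$ and $y_k\mid(x_k=x)\sim\rho_t(x,\cdot)$. - **Case (2), sliding window.** $\mu$ is ergodic, i.e. for every $s>0$ each measurable $A$ with $\rho_s(x,A)=1$ for all $x\in A$ satisfies $\mu(A)\in\{0,1\}$; $1$ lies in the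 resolvent set of $K_0^t$; and $x_k=X_{kt}$, $y_k=X_{(k+1)t}$ for a Markov process $(X_s)_{s\ge 0}$ with transition kernels $\rho_s$ and $X_0\sim\mu$. Let $$E_0(t)=\langle K^t\varphi,\varphi\rangle_\mu-\|C^t_{\mathbb H}\|_{HS}^2 .$$ Let $(e_j)$ be any orthonormal basis of $L^2_\mu$ (finite or infinite) consisting of eigenfunctions of $\mathcal E^*\mathcal E$ with eigenvalues $\lambda_j>0$ (such a basis exists), let $f_j\in\mathbb H$ be the function with $f_j=\sqrt{\lambda_j}\,e_j$ $\mu$-a.e., and put $g_{ij}=f_j\cdot K^tf_i$, $g^*_{ji}=f_i\cdot(K^t)^*f_j$, $F_m(z)=2\sum_{k=1}^{m-1}\frac{m-k}{m}z^{k-1}$, and $$\sigma_m^2=E_0(t)+\sum_{i,j}\big\langle Qg^*_{ji},F_m(K_0^t)\,Qg_{ij}\big\rangle_\mu .$$ **Proposition 3.3.** The operator $C^t_{\mathbb H}$ is Hilbert–Schmidt; in case (2) the functions $g_{ij},g^*_{ji}$ lie in $L^2_\mu$ and the series defining $\sigma_m^2$ converges absolutely. Moreover $$ \mathbb P\big(\|C_{\mathbb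 H}^t-\widehat C_{\mathbb H}^{m,t}\|_{HS}>\varepsilon\big)\le \begin{cases} \dfrac{\sigma_m^2}{m\varepsilon^2}&\text{in case (2)},\\[2mm] \dfrac{E_0(t)}{m\varepsilon^2}&\text{in case (1)},\\[2mm] 2\exp\Big(-\dfrac{m\varepsilon^2}{8\|k\|_\infty^2}\Big)&\text{in case (1), if $k$ is bounded}, \end{cases} $$ where $\|k\|_\infty=\sup_{x,y\in\mathcal X}|k(x,y)|$. For every $\psi\in\mathbb H$ with $\|\psi\|=1$ the same three bounds hold with the left-hand side replaced by $\mathbb P\big(\|\mathcal EK^t\psi-\widehat C_{\mathbb H}^{m,t}\psi\|>\varepsilon\big)$. -/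

import Mathlib

open MeasureTheory ProbabilityTheory
open scoped ENNReal NNReal

set_option linter.unusedSectionVars false

noncomputable section

namespace KoopmanRKHS

/-! ### Hilbert-Schmidt norm -/

section HilbertSchmidt

variable {H : Type*} [NormedAddCommGroup H] [InnerProductSpace ℝ H] [CompleteSpace H]

/-- `∑ i, ‖T (b i)‖ ^ 2` along an orthonormal basis `b`, as an element of `[0, ∞]`. -/
def hsSum {ι : Type*} (b : HilbertBasis ι ℝ H) (T : H →L[ℝ] H) : ℝ≥0∞ :=
  ∑' i, ‖T (b i)‖ₑ ^ 2

/-- Some orthonormal basis of `H`. -/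
def someBasis (H : Type*) [NormedAddCommGroup H] [InnerProductSpace ℝ H] [CompleteSpace H] :
    HilbertBasis (exists_hilbertBasis ℝ H).choose ℝ H :=
  (exists_hilbertBasis ℝ H).choose_spec.choose

/-- The Hilbert-Schmidt norm `(∑ i, ‖T (b i)‖ ^ 2) ^ (1 / 2)`, an element of `[0, ∞]`. By
`hsSum_eq` below it does not depend on the orthonormal basis `b`. The operator is
Hilbert-Schmidt iff the value is finite. -/
def hsNorm (T : H →L[ℝ] H) : ℝ≥0∞ := (hsSum (someBasis H) T) ^ (1 / 2 : ℝ)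

lemma tsum_enorm_inner_sq {ι : Type*} (b : HilbertBasis ι ℝ H) (v : H) :
    ∑' i, ‖inner ℝ (b i) v‖ₑ ^ 2 = ‖v‖ₑ ^ 2 := by
  have h := b.hasSum_inner_mul_inner v v
  rw [real_inner_self_eq_norm_sq] at h
  have h1 : (fun i => inner ℝ v (b i) * inner ℝ (b i) v) = fun i => ‖inner ℝ (b i) v‖ ^ 2 := by
    funext i
    rw [real_inner_comm, ← sq, Real.norm_eq_abs, sq_abs]
  rw [h1] at h
  have h2 := ENNReal.ofReal_tsum_of_nonneg (fun i => sq_nonneg ‖inner ℝ (b i) v‖) h.summable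
  rw [h.tsum_eq] at h2
  simp only [ENNReal.ofReal_pow (norm_nonneg _), ofReal_norm] at h2
  exact h2.symm

lemma hsSum_eq_adjoint {ι ι' : Type*} (b : HilbertBasis ι ℝ H) (b' : HilbertBasis ι' ℝ H)
    (T : H →L[ℝ] H) : hsSum b T = ∑' j, ‖ContinuousLinearMap.adjoint T (b' j)‖ₑ ^ 2 := by
  have h1 : ∀ i, ‖T (b i)‖ₑ ^ 2 = ∑' j, ‖inner ℝ (b' j) (T (b i))‖ₑ ^ 2 :=
    fun i => (tsum_enorm_inner_sq b' _).symm
  have h2 : ∀ j, ‖ContinuousLinearMap.adjoint T (b' j)‖ₑ ^ 2 =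
      ∑' i, ‖inner ℝ (b i) (ContinuousLinearMap.adjoint T (b' j))‖ₑ ^ 2 :=
    fun j => (tsum_enorm_inner_sq b _).symm
  rw [hsSum, tsum_congr h1, tsum_congr h2, ENNReal.tsum_comm]
  refine tsum_congr fun j => tsum_congr fun i => ?_
  rw [ContinuousLinearMap.adjoint_inner_right, real_inner_comm]

/-- The Hilbert-Schmidt norm does not depend on the orthonormal basis. -/
lemma hsSum_eq {ι ι' : Type*} (b : HilbertBasis ι ℝ H) (b' : HilbertBasis ι' ℝ H)
    (T : H →L[ℝ] H) : hsSum b T = hsSum b' T := by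
  rw [hsSum_eq_adjoint b b', hsSum_eq_adjoint b' b']

/-- A compact symmetric operator has an orthonormal basis of eigenvectors. -/
lemma exists_eigenbasis.{u} {E : Type u} [NormedAddCommGroup E] [InnerProductSpace ℝ E]
    [CompleteSpace E] {T : E →L[ℝ] E} (hcomp : IsCompactOperator T)
    (hsymm : (T : E →ₗ[ℝ] E).IsSymmetric) :
    ∃ (ι : Type u) (e : HilbertBasis ι ℝ E) (lam : ι → ℝ), ∀ j, T (e j) = lam j • e j := by
  have hcl : ∀ a : ℝ, CompleteSpace (Module.End.eigenspace (T : Module.End ℝ E) a) := by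
    intro a
    have h1 : ((Module.End.eigenspace (T : Module.End ℝ E) a : Submodule ℝ E) : Set E) =
        {v | T v = a • v} := by
      ext v; exact Module.End.mem_eigenspace_iff
    have : IsClosed ((Module.End.eigenspace (T : Module.End ℝ E) a :
        Submodule ℝ E) : Set E) := by
      rw [h1]
      exact isClosed_eq T.continuous (continuous_const_smul a)
    exact this.completeSpace_coe
  let w : ℝ → Type u := fun a =>
    (exists_hilbertBasis ℝ (Module.End.eigenspace (T : Module.End ℝ E) a)).choose
  let b : ∀ a, HilbertBasis (w a) ℝ (Module.End.eigenspace (T : Module.End ℝ E) a) := fun a =>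
    someBasis (Module.End.eigenspace (T : Module.End ℝ E) a)
  clear_value b
  clear_value w
  have hon : Orthonormal ℝ (fun p : (Σ a : ℝ, w a) => ((b p.1 p.2 : E))) :=
    hsymm.orthogonalFamily_eigenspaces.orthonormal_sigma_orthonormal
      (fun a => (b a).orthonormal)
  have hbot : (Submodule.span ℝ (Set.range
      (fun p : (Σ a : ℝ, w a) => ((b p.1 p.2 : E)))))ᗮ = ⊥ := by
    rw [eq_bot_iff, ← ContinuousLinearMap.orthogonalComplement_iSup_eigenspaces_eq_bot hcomp hsymm]
    intro v hv
    rw [Submodule.mem_orthogonal] at hv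
    rw [← Submodule.iInf_orthogonal, Submodule.mem_iInf]
    intro a
    rw [Submodule.mem_orthogonal]
    intro u hu
    have h2 : (b a).repr
        ((Module.End.eigenspace (T : Module.End ℝ E) a).orthogonalProjectionOnto v) = 0 := by
      ext i
      rw [HilbertBasis.repr_apply_apply, Submodule.inner_orthogonalProjectionOnto_eq_of_mem_left]
      exact hv _ (Submodule.subset_span ⟨⟨a, i⟩, rfl⟩)
    rw [LinearIsometryEquiv.map_eq_zero_iff] at h2
    have h3 := Submodule.inner_orthogonalProjectionOnto_eq_of_mem_left
      (K := Module.End.eigenspace (T : Module.End ℝ E) a) ⟨u, hu⟩ v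
    rw [h2, inner_zero_right] at h3
    exact h3.symm
  refine ⟨_, HilbertBasis.mkOfOrthogonalEqBot hon hbot, fun p => p.1, fun p => ?_⟩
  rw [HilbertBasis.coe_mkOfOrthogonalEqBot]
  exact Module.End.mem_eigenspace_iff.1 (b p.1 p.2).2

end HilbertSchmidt

/-! ### The Koopman operator of a Markov kernel with an invariant probability measure -/

section Koopman

variable {X : Type*} [MeasurableSpace X] {κ : Kernel X X} [IsMarkovKernel κ]
  {μ : Measure X} [IsProbabilityMeasure μ]

lemma lintegral_kernel (h : κ.Invariant μ) {g : X → ℝ≥0∞} (hg : AEMeasurable g μ) :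
    ∫⁻ x, ∫⁻ y, g y ∂κ x ∂μ = ∫⁻ x, g x ∂μ := by
  have hg' : AEMeasurable g (μ.bind κ) := by rwa [h.def]
  rw [← Measure.lintegral_bind κ.measurable.aemeasurable hg', h.def]

lemma ae_ae_kernel (h : κ.Invariant μ) {p : X → Prop} (hp : ∀ᵐ x ∂μ, p x) :
    ∀ᵐ x ∂μ, ∀ᵐ y ∂κ x, p y :=
  Measure.ae_ae_of_ae_comp (by rwa [h.def])

lemma ae_integrable_kernel (h : κ.Invariant μ) {g : X → ℝ} (hg : MemLp g 2 μ) :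
    ∀ᵐ x ∂μ, Integrable g (κ x) :=
  Measure.ae_integrable_of_integrable_comp (by rw [h.def]; exact hg.integrable one_le_two)

lemma eLpNorm_koopman_le (h : κ.Invariant μ) {g : X → ℝ} (hg : StronglyMeasurable g) :
    eLpNorm (fun x => ∫ y, g y ∂κ x) 2 μ ≤ eLpNorm g 2 μ := by
  have e : ∀ (ν : Measure X) (f : X → ℝ),
      eLpNorm f 2 ν = (∫⁻ x, ‖f x‖ₑ ^ (2 : ℝ) ∂ν) ^ (1 / 2 : ℝ) := by
    intro ν f
    rw [eLpNorm_eq_lintegral_rpow_enorm_toReal two_ne_zero ENNReal.ofNat_ne_top]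
    simp
  rw [e, e]
  refine ENNReal.rpow_le_rpow ?_ (by norm_num)
  rw [← lintegral_kernel h (g := fun x => ‖g x‖ₑ ^ (2 : ℝ))
    (hg.enorm.pow_const _).aemeasurable]
  refine lintegral_mono fun x => ?_
  have h1 : ‖∫ y, g y ∂κ x‖ₑ ≤ eLpNorm g 2 (κ x) := by
    refine (enorm_integral_le_lintegral_enorm _).trans ?_
    rw [← eLpNorm_one_eq_lintegral_enorm]
    exact eLpNorm_le_eLpNorm_of_exponent_le one_le_two hg.aestronglyMeasurable
  refine (ENNReal.rpow_le_rpow h1 (by norm_num)).trans ?_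
  rw [e, ← ENNReal.rpow_mul]
  norm_num

lemma memLp_koopman (h : κ.Invariant μ) (ψ : Lp ℝ 2 μ) :
    MemLp (fun x => ∫ y, ψ y ∂κ x) 2 μ :=
  ⟨(Lp.stronglyMeasurable ψ).integral_kernel.aestronglyMeasurable,
    (eLpNorm_koopman_le h (Lp.stronglyMeasurable ψ)).trans_lt (Lp.memLp ψ).2⟩

/-- The Koopman operator `(K ψ)(x) = ∫ ψ(y) κ(x, dy)` on `L²(μ)`, a contraction. -/
def koopman (h : κ.Invariant μ) : Lp ℝ 2 μ →L[ℝ] Lp ℝ 2 μ :=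
  LinearMap.mkContinuous
    { toFun := fun ψ => (memLp_koopman h ψ).toLp (fun x => ∫ y, ψ y ∂κ x)
      map_add' := by
        intro ψ η
        rw [← MemLp.toLp_add]
        refine MemLp.toLp_congr _ _ ?_
        filter_upwards [ae_ae_kernel h (Lp.coeFn_add ψ η), ae_integrable_kernel h (Lp.memLp ψ),
          ae_integrable_kernel h (Lp.memLp η)] with x hx h1 h2
        rw [integral_congr_ae hx]
        exact integral_add h1 h2
      map_smul' := by
        intro c ψ
        rw [RingHom.id_apply, ← MemLp.toLp_const_smul]
        refine MemLp.toLp_congr _ _ ?_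
        filter_upwards [ae_ae_kernel h (Lp.coeFn_smul c ψ)] with x hx
        rw [integral_congr_ae hx]
        exact integral_smul c _ }
    1 (by
      intro ψ
      rw [one_mul]
      change ‖(memLp_koopman h ψ).toLp _‖ ≤ _
      rw [Lp.norm_toLp, Lp.norm_def]
      exact ENNReal.toReal_mono (Lp.memLp ψ).2.ne
        (eLpNorm_koopman_le h (Lp.stronglyMeasurable ψ)))

lemma koopman_apply (h : κ.Invariant μ) (ψ : Lp ℝ 2 μ) :
    koopman h ψ = (memLp_koopman h ψ).toLp (fun x => ∫ y, ψ y ∂κ x) := rfl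

lemma integral_koopman (h : κ.Invariant μ) (ψ : Lp ℝ 2 μ) :
    ∫ x, koopman h ψ x ∂μ = ∫ x, ψ x ∂μ := by
  rw [koopman_apply, integral_congr_ae (MemLp.coeFn_toLp _)]
  have hi : Integrable ψ (μ.bind κ) := by
    rw [h.def]
    exact (Lp.memLp ψ).integrable one_le_two
  rw [Measure.comp_eq_comp_const_apply] at hi
  have h1 := Kernel.integral_comp hi
  rw [← Measure.comp_eq_comp_const_apply, h.def, Kernel.const_apply] at h1
  exact h1.symm

variable (μ) in
/-- The constant function `1` in `L²(μ)`. -/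
def oneL2 : Lp ℝ 2 μ := (memLp_const (1 : ℝ)).toLp (fun _ : X => (1 : ℝ))

lemma inner_oneL2 (ψ : Lp ℝ 2 μ) : inner ℝ (oneL2 μ) ψ = ∫ x, ψ x ∂μ := by
  rw [L2.inner_def]
  refine integral_congr_ae ?_
  filter_upwards [MemLp.coeFn_toLp (memLp_const (1 : ℝ) (μ := μ) (p := 2))] with x hx
  rw [oneL2, hx]
  simp

variable (μ) in
/-- `L²₀(μ)`, the orthogonal complement of the constant functions. -/
def L20 : Submodule ℝ (Lp ℝ 2 μ) := (Submodule.span ℝ {oneL2 μ})ᗮ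

instance : (L20 μ).HasOrthogonalProjection := by
  unfold L20; infer_instance

/-- The restriction `K₀` of the Koopman operator to the orthogonal complement of the constants. -/
def koopman0 (h : κ.Invariant μ) : L20 μ →L[ℝ] L20 μ :=
  ((koopman h).comp (L20 μ).subtypeL).codRestrict (L20 μ) (by
    intro ψ
    have hψ : inner ℝ (oneL2 μ) (ψ : Lp ℝ 2 μ) = 0 :=
      Submodule.mem_orthogonal_singleton_iff_inner_right.1 ψ.2
    refine Submodule.mem_orthogonal_singleton_iff_inner_right.2 ?_
    rw [inner_oneL2] at hψ ⊢
    rw [← hψ]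
    exact integral_koopman h ψ)

end Koopman

/-! ### Reproducing kernel Hilbert spaces -/

section Kernel

universe u

variable {X : Type u} (H : Type*) [NormedAddCommGroup H] [InnerProductSpace ℝ H]
  [CompleteSpace H] [RKHS ℝ H X ℝ]

/-- The feature map `Φ(x) = k(x, ·) ∈ H`. -/
def feature (x : X) : H := RKHS.kerFun H x 1

/-- The scalar reproducing kernel `k(x, y)` of `H`. -/
def kfun (x y : X) : ℝ := feature H x y

/-- The kernel diagonal `φ(x) = k(x, x)`. -/
def kdiag (x : X) : ℝ := kfun H x x

lemma inner_feature (x : X) (ψ : H) : inner ℝ (feature H x) ψ = ψ x := by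
  simp [feature]

lemma inner_feature_feature (x y : X) : inner ℝ (feature H x) (feature H y) = kfun H x y := by
  rw [real_inner_comm, inner_feature, kfun]

lemma norm_feature_sq (x : X) : ‖feature H x‖ ^ 2 = kdiag H x := by
  rw [← real_inner_self_eq_norm_sq, inner_feature_feature, kdiag]

/-- The rank-one operator `C_{xy} ψ = ⟨ψ, Φ(y)⟩ Φ(x) = ψ(y) Φ(x)`. -/
def rankOneOp (x y : X) : H →L[ℝ] H := InnerProductSpace.rankOne ℝ (feature H x) (feature H y)

lemma rankOneOp_apply (x y : X) (ψ : H) : rankOneOp H x y ψ = ψ y • feature H x := by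
  simp [rankOneOp, InnerProductSpace.rankOne_apply, inner_feature]

/-- The empirical estimator `(1 / m) ∑ k, C_{x_k, y_k}`. -/
def empirical {m : ℕ} (x y : Fin m → X) : H →L[ℝ] H :=
  (m : ℝ)⁻¹ • ∑ k, rankOneOp H (x k) (y k)

/-- `‖k‖_∞ = sup_{x, y} |k(x, y)|`, meaningful for a bounded kernel. -/
def kernelSup : ℝ := ⨆ p : X × X, |kfun H p.1 p.2|

/-- The kernel is bounded. -/
def IsBoundedKernel : Prop := BddAbove (Set.range fun p : X × X => |kfun H p.1 p.2|)

variable [TopologicalSpace X] [MeasurableSpace X]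

/-- The kernel of `H` is continuous and satisfies the compatibility assumptions (A1), (A2), (A3)
with respect to the measure `μ`. -/
structure Compatible (μ : Measure X) : Prop where
  continuous_kernel : Continuous fun p : X × X => kfun H p.1 p.2
  memLp_diag : MemLp (kdiag H) 2 μ
  eq_zero_of_integral : ∀ ψ : Lp ℝ 2 μ,
    ∫ x, ∫ y, kfun H x y * ψ x * ψ y ∂μ ∂μ = 0 → ψ = 0
  eq_zero_of_ae : ∀ ψ : H, (∀ᵐ x ∂μ, ψ x = 0) → ∀ x, ψ x = 0

variable {H}
variable {μ : Measure X}

lemma Compatible.continuous_feature (hc : Compatible H μ) : Continuous (feature H : X → H) := by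
  have hk := hc.continuous_kernel
  rw [continuous_iff_continuousAt]
  intro x
  rw [ContinuousAt, tendsto_iff_norm_sub_tendsto_zero]
  generalize hF : (fun p : X × X => kfun H p.1 p.2) = F at hk
  have hF' : ∀ y z : X, kfun H y z = F (y, z) := fun y z => by rw [← hF]
  have c1 : Continuous fun y : X => F (y, y) := hk.comp (continuous_id.prodMk continuous_id)
  have c2 : Continuous fun y : X => F (y, x) := hk.comp (continuous_id.prodMk continuous_const)
  have h3 : (fun y => ‖feature H y - feature H x‖) =
      fun y => √(F (y, y) - 2 * F (y, x) + F (x, x)) := by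
    funext y
    rw [← hF', ← hF', ← hF', ← Real.sqrt_sq (norm_nonneg (feature H y - feature H x)), norm_sub_sq_real,
      norm_feature_sq, norm_feature_sq, inner_feature_feature, kdiag, kdiag]
  have h4 : Continuous fun y : X => √(F (y, y) - 2 * F (y, x) + F (x, x)) :=
    ((c1.sub (c2.const_mul 2)).add continuous_const).sqrt
  rw [h3]
  convert h4.tendsto x using 2
  rw [show F (x, x) - 2 * F (x, x) + F (x, x) = 0 by ring, Real.sqrt_zero]

variable [SecondCountableTopology X] [BorelSpace X] [IsProbabilityMeasure μ]

lemma Compatible.memLp_feature (hc : Compatible H μ) : MemLp (feature H : X → H) 2 μ := by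
  have hm : AEStronglyMeasurable (feature H : X → H) μ :=
    hc.continuous_feature.aestronglyMeasurable
  rw [memLp_two_iff_integrable_sq_norm hm]
  have h1 : (fun x : X => ‖feature H x‖ ^ 2) = kdiag H := funext fun x => norm_feature_sq H x
  rw [h1]
  exact hc.memLp_diag.integrable one_le_two

lemma Compatible.memLp_coe (hc : Compatible H μ) (ψ : H) : MemLp (ψ : X → ℝ) 2 μ := by
  have h1 : (ψ : X → ℝ) = fun x => inner ℝ (feature H x) ψ :=
    funext fun x => (inner_feature H x ψ).symm
  rw [h1]
  exact hc.memLp_feature.inner_const ψ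

/-- The inclusion `H → L²(μ)`, sending a function to its `μ`-a.e. class. -/
def incl (hc : Compatible H μ) : H →L[ℝ] Lp ℝ 2 μ :=
  LinearMap.mkContinuous
    { toFun := fun ψ => (hc.memLp_coe ψ).toLp (ψ : X → ℝ)
      map_add' := by
        intro ψ η
        rw [← MemLp.toLp_add]
        exact MemLp.toLp_congr _ _ (Filter.Eventually.of_forall fun x => by simp)
      map_smul' := by
        intro c ψ
        rw [RingHom.id_apply, ← MemLp.toLp_const_smul]
        exact MemLp.toLp_congr _ _ (Filter.Eventually.of_forall fun x => by simp) }
    (eLpNorm (feature H : X → H) 2 μ).toReal (by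
      intro ψ
      change ‖(hc.memLp_coe ψ).toLp _‖ ≤ _
      rw [Lp.norm_toLp, mul_comm, ← ENNReal.toReal_ofReal (norm_nonneg ψ), ← ENNReal.toReal_mul]
      refine ENNReal.toReal_mono (ENNReal.mul_ne_top ENNReal.ofReal_ne_top
        hc.memLp_feature.2.ne) ?_
      refine eLpNorm_le_mul_eLpNorm_of_ae_le_mul (Filter.Eventually.of_forall fun x => ?_) 2
      rw [← inner_feature H x ψ, mul_comm]
      exact norm_inner_le_norm _ _)

lemma integral_smul_feature (hc : Compatible H μ) (ψ : Lp ℝ 2 μ) :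
    ∫ x, ψ x • feature H x ∂μ =
      (ContinuousLinearMap.lsmul ℝ ℝ).lpPairing μ 2 2 ψ (hc.memLp_feature.toLp _) := by
  rw [ContinuousLinearMap.lpPairing_eq_integral]
  refine integral_congr_ae ?_
  filter_upwards [hc.memLp_feature.coeFn_toLp] with x hx
  rw [hx, ContinuousLinearMap.lsmul_apply]

/-- The integral operator `E : L²(μ) → H`, `E ψ = ∫ ψ(x) Φ(x) dμ(x)`, a Bochner integral
in `H`. -/
def embed (hc : Compatible H μ) : Lp ℝ 2 μ →L[ℝ] H :=
  LinearMap.mkContinuous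
    { toFun := fun ψ => ∫ x, ψ x • feature H x ∂μ
      map_add' := by
        intro ψ η
        simp only [integral_smul_feature hc, map_add, add_apply]
      map_smul' := by
        intro c ψ
        simp only [integral_smul_feature hc, map_smul, smul_apply,
          RingHom.id_apply] }
    ‖((ContinuousLinearMap.lsmul ℝ ℝ).lpPairing μ 2 2).flip (hc.memLp_feature.toLp _)‖ (by
      intro ψ
      change ‖∫ x, ψ x • feature H x ∂μ‖ ≤ _
      rw [integral_smul_feature hc]
      exact (((ContinuousLinearMap.lsmul ℝ ℝ).lpPairing μ 2 2).flip
        (hc.memLp_feature.toLp _)).le_opNorm ψ)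

lemma embed_apply (hc : Compatible H μ) (ψ : Lp ℝ 2 μ) :
    embed hc ψ = ∫ x, ψ x • feature H x ∂μ := rfl

/-- The cross-covariance operator `C = E K E^*` on `H`, i.e. `C ψ = ∫ (K ψ)(x) Φ(x) dμ(x)`;
the adjoint `E^*` is the inclusion of `H` in `L²(μ)`. -/
def crossCov (hc : Compatible H μ) {κ : Kernel X X} [IsMarkovKernel κ] (h : κ.Invariant μ) :
    H →L[ℝ] H :=
  (embed hc).comp ((koopman h).comp (incl hc))

lemma inner_embed (hc : Compatible H μ) (ψ : Lp ℝ 2 μ) (η : H) :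
    inner ℝ (embed hc ψ) η = inner ℝ ψ (incl hc η) := by
  rw [embed_apply, real_inner_comm, ← integral_inner]
  · rw [L2.inner_def]
    refine integral_congr_ae ?_
    filter_upwards [(hc.memLp_coe η).coeFn_toLp] with x hx
    change _ = inner ℝ (ψ x) ((hc.memLp_coe η).toLp _ x)
    rw [hx, real_inner_smul_right, real_inner_comm, inner_feature]
    simp [mul_comm]
  · exact memLp_one_iff_integrable.1 (hc.memLp_feature.smul (Lp.memLp ψ))

lemma adjoint_embed (hc : Compatible H μ) :
    ContinuousLinearMap.adjoint (embed hc) = incl hc := by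
  rw [eq_comm, ContinuousLinearMap.eq_adjoint_iff]
  intro η ψ
  rw [real_inner_comm, ← inner_embed, real_inner_comm]

/-- `E_0 = ⟨K φ, φ⟩_μ - ‖C‖_HS ^ 2`, with `φ` the kernel diagonal and `C = E K E^*`. -/
def E0 (hc : Compatible H μ) {κ : Kernel X X} [IsMarkovKernel κ] (h : κ.Invariant μ) : ℝ :=
  inner ℝ (koopman h (hc.memLp_diag.toLp (kdiag H))) (hc.memLp_diag.toLp (kdiag H))
    - (hsNorm (crossCov hc h)).toReal ^ 2

/-- A Mercer basis: `e` is an orthonormal basis of `L²(μ)` made of eigenfunctions of `E^* E` with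
eigenvalues `lam j > 0`, and `f j ∈ H` is the function `√(lam j) e j`. -/
structure IsMercerBasis (hc : Compatible H μ) {ι : Type*} (e : HilbertBasis ι ℝ (Lp ℝ 2 μ))
    (lam : ι → ℝ) (f : ι → H) : Prop where
  pos : ∀ j, 0 < lam j
  eigen : ∀ j, ContinuousLinearMap.adjoint (embed hc) (embed hc (e j)) = lam j • e j
  incl_eq : ∀ j, incl hc (f j) = √(lam j) • e j

lemma isCompactOperator_embed (hc : Compatible H μ) : IsCompactOperator (embed hc) := by
  have key : ∀ g : Lp H 2 μ, IsCompactOperator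
      (((ContinuousLinearMap.lsmul ℝ ℝ).lpPairing μ 2 2).flip g : Lp ℝ 2 μ →L[ℝ] H) := by
    intro g
    set L := ((ContinuousLinearMap.lsmul ℝ ℝ (E := H)).lpPairing μ 2 2).flip with hL
    refine Lp.induction (motive := fun g => IsCompactOperator (L g : Lp ℝ 2 μ →L[ℝ] H))
      ENNReal.ofNat_ne_top ?_ ?_ ?_ g
    · intro c s hs hμs
      have e : L ((Lp.simpleFunc.indicatorConst 2 hs hμs.ne c : Lp.simpleFunc H 2 μ) : Lp H 2 μ) =
          (ContinuousLinearMap.toSpanSingleton ℝ c).comp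
            (innerSL ℝ (indicatorConstLp 2 hs hμs.ne (1 : ℝ))) := by
        ext1 ψ
        rw [hL, ContinuousLinearMap.flip_apply, ContinuousLinearMap.lpPairing_eq_integral,
          ContinuousLinearMap.comp_apply, innerSL_apply_apply, L2.inner_indicatorConstLp_one,
          ContinuousLinearMap.toSpanSingleton_apply, ← integral_smul_const,
          ← integral_indicator hs]
        refine integral_congr_ae ?_
        filter_upwards [indicatorConstLp_coeFn (p := 2) (hs := hs) (hμs := hμs.ne) (c := c)]
          with x hx
        rw [Lp.simpleFunc.coe_indicatorConst, hx, ContinuousLinearMap.lsmul_apply]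
        by_cases h : x ∈ s <;> simp [h]
      rw [e]
      have h1 : IsCompactOperator
          (innerSL ℝ (indicatorConstLp 2 hs hμs.ne (1 : ℝ)) : Lp ℝ 2 μ →L[ℝ] ℝ) :=
        isCompactOperator_of_locallyCompactSpace_dom _
      exact h1.clm_comp (ContinuousLinearMap.toSpanSingleton ℝ c)
    · intro f g hf hg hd h1 h2
      simp only [map_add]
      exact h1.add h2
    · have hcl : IsClosed {A : Lp ℝ 2 μ →L[ℝ] H | IsCompactOperator A} :=
        isClosed_setOfPred_isCompactOperator
      exact hcl.preimage L.continuous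
  have h1 : (embed hc : Lp ℝ 2 μ → H) = ((ContinuousLinearMap.lsmul ℝ ℝ).lpPairing μ 2 2).flip
      (hc.memLp_feature.toLp _) := by
    funext ψ
    exact integral_smul_feature hc ψ
  rw [h1]
  exact key _

lemma embed_injective (hc : Compatible H μ) {ψ : Lp ℝ 2 μ} (h : embed hc ψ = 0) : ψ = 0 := by
  refine hc.eq_zero_of_integral ψ ?_
  have h0 : ∀ x, ∫ y, kfun H x y * ψ x * ψ y ∂μ = 0 := by
    intro x
    have h1 : inner ℝ (embed hc ψ) (feature H x) = ∫ y, kfun H x y * ψ y ∂μ := by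
      rw [inner_embed, L2.inner_def]
      refine integral_congr_ae ?_
      filter_upwards [(hc.memLp_coe (feature H x)).coeFn_toLp] with y hy
      change inner ℝ (ψ y) ((hc.memLp_coe (feature H x)).toLp _ y) = _
      rw [hy]
      simp [kfun]
    rw [h, inner_zero_left] at h1
    have h2 : (fun y => kfun H x y * ψ x * ψ y) = fun y => ψ x * (kfun H x y * ψ y) := by
      funext y; ring
    rw [h2, integral_const_mul, ← h1, mul_zero]
  simp [h0]

/-- Mercer bases exist. -/
lemma exists_isMercerBasis (hc : Compatible H μ) :
    ∃ (ι : Type u) (e : HilbertBasis ι ℝ (Lp ℝ 2 μ)) (lam : ι → ℝ) (f : ι → H),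
      IsMercerBasis hc e lam f := by
  have hcomp : IsCompactOperator
      ((ContinuousLinearMap.adjoint (embed hc)).comp (embed hc)) :=
    (isCompactOperator_embed hc).clm_comp (ContinuousLinearMap.adjoint (embed hc))
  have hsymm : (((ContinuousLinearMap.adjoint (embed hc)).comp (embed hc) :
      Lp ℝ 2 μ →L[ℝ] Lp ℝ 2 μ) : Lp ℝ 2 μ →ₗ[ℝ] Lp ℝ 2 μ).IsSymmetric := by
    intro a b
    change inner ℝ (ContinuousLinearMap.adjoint (embed hc) (embed hc a)) b =
      inner ℝ a (ContinuousLinearMap.adjoint (embed hc) (embed hc b))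
    rw [ContinuousLinearMap.adjoint_inner_left, ContinuousLinearMap.adjoint_inner_right]
  obtain ⟨ι, e, lam, heig⟩ := exists_eigenbasis hcomp hsymm
  have hpos : ∀ p, 0 < lam p := by
    intro p
    have hn : ‖e p‖ = 1 := e.orthonormal.1 p
    have h1 : lam p = ‖embed hc (e p)‖ ^ 2 := by
      have h2 : ContinuousLinearMap.adjoint (embed hc) (embed hc (e p)) = lam p • e p := heig p
      rw [← real_inner_self_eq_norm_sq, ← ContinuousLinearMap.adjoint_inner_right, h2,
        real_inner_smul_right, real_inner_self_eq_norm_sq, hn]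
      simp
    rw [h1]
    refine pow_pos (norm_pos_iff.2 fun h => ?_) 2
    rw [embed_injective hc h, norm_zero] at hn
    exact zero_ne_one hn
  refine ⟨ι, e, lam, fun p => (√(lam p))⁻¹ • embed hc (e p), hpos, heig, fun p => ?_⟩
  have h2 : ContinuousLinearMap.adjoint (embed hc) (embed hc (e p)) = lam p • e p := heig p
  rw [map_smul, ← adjoint_embed, h2, smul_smul]
  congr 1
  rw [inv_mul_eq_div, Real.div_sqrt]

section Variance

variable (hc : Compatible H μ) {κ : Kernel X X} [IsMarkovKernel κ] (h : κ.Invariant μ)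
  {ι : Type*} (f : ι → H)

/-- `g_{ij} = f_j · K f_i`. -/
def gFun (i j : ι) : X → ℝ := fun x => f j x * koopman h (incl hc (f i)) x

/-- `g*_{ji} = f_i · K^* f_j`. -/
def gStarFun (j i : ι) : X → ℝ := fun x =>
  f i x * ContinuousLinearMap.adjoint (koopman h) (incl hc (f j)) x

open Classical in
/-- The class in `L²(μ)` of a square integrable function (`0` if it is not square integrable). -/
def toL2 (μ : Measure X) (g : X → ℝ) : Lp ℝ 2 μ := if hg : MemLp g 2 μ then hg.toLp g else 0

/-- `F_m(T) = 2 ∑_{k=1}^{m-1} ((m - k) / m) T ^ (k - 1)`. -/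
def Fpoly {A : Type*} [Ring A] [Algebra ℝ A] (m : ℕ) (T : A) : A :=
  ∑ k ∈ Finset.Icc 1 (m - 1), (2 * (((m : ℝ) - (k : ℝ)) / (m : ℝ))) • T ^ (k - 1)

/-- The summand `⟨Q g*_{ji}, F_m(K₀) Q g_{ij}⟩_μ`, where `Q` is the orthogonal projection of
`L²(μ)` onto the complement of the constants. -/
def varTerm (m : ℕ) (p : ι × ι) : ℝ :=
  inner ℝ ((L20 μ).orthogonalProjectionOnto (toL2 μ (gStarFun hc h f p.2 p.1)))
    (Fpoly m (koopman0 h) ((L20 μ).orthogonalProjectionOnto (toL2 μ (gFun hc h f p.1 p.2))))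

/-- `σ_m² = E_0 + ∑_{i,j} ⟨Q g*_{ji}, F_m(K₀) Q g_{ij}⟩_μ`. -/
def sigmaSq (m : ℕ) : ℝ := E0 hc h + ∑' p : ι × ι, varTerm hc h f m p

end Variance

end Kernel

/-! ### Markov processes and sampling schemes -/

section Sampling

/-- The transition semigroup `(ρ_t)_{t ≥ 0}` of a time-homogeneous Markov process. -/
structure TransitionSemigroup (X : Type*) [MeasurableSpace X] where
  ker : ℝ≥0 → Kernel X X
  isMarkov : ∀ t, IsMarkovKernel (ker t)
  zero : ker 0 = Kernel.id
  add : ∀ s t, ker (s + t) = ker t ∘ₖ ker s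

variable {X : Type*} [MeasurableSpace X]

instance (ρ : TransitionSemigroup X) (t : ℝ≥0) : IsMarkovKernel (ρ.ker t) := ρ.isMarkov t

/-- `μ` is invariant: `∫ ρ_t(x, A) dμ(x) = μ(A)` for all `t ≥ 0`. -/
def TransitionSemigroup.IsInvariant (ρ : TransitionSemigroup X) (μ : Measure X) : Prop :=
  ∀ t, (ρ.ker t).Invariant μ

/-- `μ` is ergodic: for every `t > 0`, every `ρ_t`-invariant measurable set has measure
`0` or `1`. -/
def TransitionSemigroup.IsErgodic (ρ : TransitionSemigroup X) (μ : Measure X) : Prop :=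
  ∀ t, 0 < t → ∀ A, MeasurableSet A → (∀ x ∈ A, ρ.ker t x A = 1) → μ A = 0 ∨ μ A = 1

variable {Ω : Type*} [MeasurableSpace Ω]

/-- The `σ`-algebra generated by `Z r`, `r ≤ s`. -/
abbrev past (Z : ℝ≥0 → Ω → X) (s : ℝ≥0) : MeasurableSpace Ω :=
  ⨆ r : Set.Iic s, MeasurableSpace.comap (Z r) inferInstance

/-- `Z` is a Markov process with transition kernels `ρ_t` and initial distribution `μ`:
`P(Z_{s+t} ∈ A | Z_r, r ≤ s) = ρ_t(Z_s, A)` almost surely. -/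
structure IsMarkovProcess (ρ : TransitionSemigroup X) (μ : Measure X) (P : Measure Ω)
    (Z : ℝ≥0 → Ω → X) : Prop where
  measurable : ∀ t, Measurable (Z t)
  map_zero : P.map (Z 0) = μ
  markov : ∀ s t, ∀ A, MeasurableSet A →
    P[(Z (s + t) ⁻¹' A).indicator (fun _ => (1 : ℝ)) | past Z s]
      =ᵐ[P] fun ω => (ρ.ker t (Z s ω)).real A

/-- The pairs `(x_k, y_k)` are independent with `x_k ∼ μ` and `y_k | (x_k = x) ∼ κ(x, ·)`, that
is, with joint distribution `κ(x, dy) dμ(x)`. -/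
structure IsIIDSample {m : ℕ} (κ : Kernel X X) (μ : Measure X) (P : Measure Ω)
    (x y : Fin m → Ω → X) : Prop where
  measurable_fst : ∀ k, Measurable (x k)
  measurable_snd : ∀ k, Measurable (y k)
  map_pair : ∀ k, P.map (fun ω => (x k ω, y k ω)) = μ ⊗ₘ κ
  indep : iIndepFun (fun k ω => (x k ω, y k ω)) P

end Sampling

end KoopmanRKHS

end

open KoopmanRKHS

open MeasureTheory ProbabilityTheory
open scoped ENNReal NNReal

noncomputable section

namespace KoopmanRKHS

/-! ### Hilbert-Schmidt operators as square summable matrices -/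

section Matrices

/-! Fix an orthonormal basis `b` of the kernel space. Hilbert–Schmidt operators become square
summable matrices, and `pairVec` turns $C_{xy}$ into a random vector of the Hilbert space
$\ell^2(\iota\times\iota)$ with squared norm $\varphi(x)\varphi(y)$. Under the joint law
$\mu\otimes\rho_t$ its Bochner mean is the matrix of $C^t_{\mathbb H}$
(`integral_pairVec_apply_eq_inner`). So the estimation error is, up to sign, an average of $m$
centered, identically distributed vectors $\zeta_k$ with $E\|\zeta_k\|^2=E_0(t)$
(`hsNorm_crossCov_sub_empirical`, `integral_norm_centeredVec_sq`). The error at a unit vector is at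
most the Hilbert–Schmidt error.

Chebyshev bounds the tail by $(m\varepsilon)^{-2}\sum_{k,l}E\langle\zeta_k,\zeta_l\rangle$. For
independent data only the diagonal survives. For a bounded kernel $\|\zeta_k\|\le2\|k\|_\infty$, and
the exponential bound is Hoeffding's inequality in Hilbert space, proved by bounding
$E\cosh\|\sum_k\zeta_k\|$ one summand at a time (`integral_cosh_norm_sum_le`).

For the sliding window take $b=(f_j)$, which is an orthonormal basis of the kernel space
(`IsMercerBasis.exists_hilbertBasis`). The entries of the two matrices are $f_j(x_k)f_i(y_k)$ and
$f_j(x_l)f_i(y_l)$ with $l=k+1+n$. Conditioning the second on $x_l$ gives $g_{ij}(x_l)$,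
conditioning the first on $y_k$ gives $g^*_{ji}(y_k)$, and $n$ steps separate $y_k$ from $x_l$;
after centering the covariance is $\langle Qg^*_{ji},(K_0^t)^nQg_{ij}\rangle$
(`IsMarkovProcess.integral_centeredVec_mul_centeredVec`). Lag $n+1$ occurs $2(m-n-1)$ times, which
produces $F_m$. The functions $g$ and $g^*$ are conditional expectations of a matrix entry, so their
$L^2$ norms are at most that of the entry; since $E\|C_{xy}\|_{HS}^2<\infty$, this gives both square
integrability and absolute convergence. -/

lemma hasSum_sq_lp {α : Type*} (v : lp (fun _ : α => ℝ) 2) :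
    HasSum (fun p => v p ^ 2) (‖v‖ ^ 2) := by
  have h := lp.hasSum_inner (𝕜 := ℝ) v v
  rw [real_inner_self_eq_norm_sq] at h
  simpa [sq] using h

lemma tsum_enorm_sq_lp {α : Type*} (v : lp (fun _ : α => ℝ) 2) :
    ∑' p, ‖v p‖ₑ ^ 2 = ‖v‖ₑ ^ 2 := by
  have h := hasSum_sq_lp v
  have h2 := ENNReal.ofReal_tsum_of_nonneg (fun p => sq_nonneg (v p)) h.summable
  rw [h.tsum_eq, ENNReal.ofReal_pow (norm_nonneg _), ofReal_norm] at h2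
  rw [h2]
  refine tsum_congr fun p => ?_
  rw [← ofReal_norm, ← ENNReal.ofReal_pow (norm_nonneg _), Real.norm_eq_abs, sq_abs]

variable {H : Type*} [NormedAddCommGroup H] [InnerProductSpace ℝ H] [CompleteSpace H]

lemma hasSum_inner_sq {ι : Type*} (b : HilbertBasis ι ℝ H) (v : H) :
    HasSum (fun i => inner ℝ (b i) v ^ 2) (‖v‖ ^ 2) := by
  have h := b.hasSum_inner_mul_inner v v
  rw [real_inner_self_eq_norm_sq] at h
  refine h.congr_fun fun i => ?_
  rw [real_inner_comm, sq]

lemma hasSum_inner_sq_mul {ι : Type*} (b : HilbertBasis ι ℝ H) (u v : H) :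
    HasSum (fun p : ι × ι => (inner ℝ (b p.2) u * inner ℝ (b p.1) v) ^ 2)
      (‖u‖ ^ 2 * ‖v‖ ^ 2) := by
  have hu := hasSum_inner_sq b u
  have hv := hasSum_inner_sq b v
  have h := hv.mul hu (hv.summable.mul_of_nonneg hu.summable (fun _ => sq_nonneg _)
    fun _ => sq_nonneg _)
  rw [mul_comm]
  refine h.congr_fun fun p => ?_
  ring

/-- The matrix `⟨b j, u⟩ ⟨b i, v⟩` of the rank-one operator `w ↦ ⟨v, w⟩ u`, indexed by `(i, j)`. -/
def rankOneVec {ι : Type*} (b : HilbertBasis ι ℝ H) (u v : H) : lp (fun _ : ι × ι => ℝ) 2 :=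
  ⟨fun p => inner ℝ (b p.2) u * inner ℝ (b p.1) v,
    memℓp_gen (by simpa [mul_pow] using (hasSum_inner_sq_mul b u v).summable)⟩

lemma rankOneVec_apply {ι : Type*} (b : HilbertBasis ι ℝ H) (u v : H) (p : ι × ι) :
    rankOneVec b u v p = inner ℝ (b p.2) u * inner ℝ (b p.1) v := rfl

lemma norm_rankOneVec {ι : Type*} (b : HilbertBasis ι ℝ H) (u v : H) :
    ‖rankOneVec b u v‖ = ‖u‖ * ‖v‖ := by
  have h1 := hasSum_sq_lp (rankOneVec b u v)
  simp only [rankOneVec_apply] at h1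
  rw [← sq_eq_sq₀ (norm_nonneg _) (mul_nonneg (norm_nonneg _) (norm_nonneg _)),
    h1.unique (hasSum_inner_sq_mul b u v), mul_pow]

/-- `rankOneVec` as a bounded bilinear map. -/
def rankOneMatrix {ι : Type*} (b : HilbertBasis ι ℝ H) :
    H →L[ℝ] H →L[ℝ] lp (fun _ : ι × ι => ℝ) 2 :=
  LinearMap.mkContinuous₂
    (LinearMap.mk₂ ℝ (rankOneVec b)
      (fun u u' v => by
        ext p
        rw [lp.coeFn_add, Pi.add_apply]
        simp only [rankOneVec_apply, inner_add_right, add_mul])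
      (fun c u v => by
        ext p
        rw [lp.coeFn_smul, Pi.smul_apply]
        simp only [rankOneVec_apply, inner_smul_right, mul_assoc, smul_eq_mul])
      (fun u v v' => by
        ext p
        rw [lp.coeFn_add, Pi.add_apply]
        simp only [rankOneVec_apply, inner_add_right, mul_add])
      (fun c u v => by
        ext p
        rw [lp.coeFn_smul, Pi.smul_apply]
        simp only [rankOneVec_apply, inner_smul_right, smul_eq_mul]
        ring))
    1 (fun u v => by rw [one_mul]; exact (norm_rankOneVec b u v).le)

lemma rankOneMatrix_apply {ι : Type*} (b : HilbertBasis ι ℝ H) (u v : H) (p : ι × ι) :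
    rankOneMatrix b u v p = inner ℝ (b p.2) u * inner ℝ (b p.1) v := rfl

lemma norm_rankOneMatrix {ι : Type*} (b : HilbertBasis ι ℝ H) (u v : H) :
    ‖rankOneMatrix b u v‖ = ‖u‖ * ‖v‖ := norm_rankOneVec b u v

/-- Parseval in each column `T (b i)`. This moves Hilbert–Schmidt norms into a fixed Hilbert space,
where Bochner integrals and independence arguments are available. -/
lemma hsNorm_eq_enorm {ι : Type*} (b : HilbertBasis ι ℝ H) (T : H →L[ℝ] H)
    (v : lp (fun _ : ι × ι => ℝ) 2) (hv : ∀ p, v p = inner ℝ (b p.2) (T (b p.1))) :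
    hsNorm T = ‖v‖ₑ := by
  have h : hsSum b T = ‖v‖ₑ ^ 2 := by
    rw [← tsum_enorm_sq_lp, ENNReal.tsum_prod', hsSum]
    refine tsum_congr fun i => ?_
    rw [← tsum_enorm_inner_sq b]
    exact tsum_congr fun j => by rw [hv]
  rw [hsNorm, hsSum_eq _ b, h, ← ENNReal.rpow_natCast, ← ENNReal.rpow_mul]
  norm_num

/-- Passing to the adjoint, $\|T\psi\|^2=\sum_j\langle T^*b_j,\psi\rangle^2\le\sum_j\|T^*b_j\|^2$,
so `ψ` need not be completed to an orthonormal basis. -/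
lemma enorm_apply_le_hsNorm (T : H →L[ℝ] H) {ψ : H} (hψ : ‖ψ‖ = 1) : ‖T ψ‖ₑ ≤ hsNorm T := by
  have h : ‖T ψ‖ₑ ^ 2 ≤ hsSum (someBasis H) T := by
    rw [hsSum_eq_adjoint (someBasis H) (someBasis H), ← tsum_enorm_inner_sq (someBasis H)]
    refine ENNReal.tsum_le_tsum fun j => ?_
    gcongr
    rw [← ContinuousLinearMap.adjoint_inner_left, ← ofReal_norm, ← ofReal_norm]
    refine ENNReal.ofReal_le_ofReal ((norm_inner_le_norm _ _).trans ?_)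
    rw [hψ, mul_one]
  calc ‖T ψ‖ₑ = (‖T ψ‖ₑ ^ 2) ^ (1 / 2 : ℝ) := by
        rw [← ENNReal.rpow_natCast, ← ENNReal.rpow_mul]; norm_num
    _ ≤ _ := ENNReal.rpow_le_rpow h (by norm_num)

end Matrices

/-! ### Hoeffding's inequality in Hilbert space -/

section Hoeffding

/-- The bound on $a^2$ is the convex combination of $(r+c)^2$ and $(r-c)^2$ with weights
$(1\pm\theta)/2$. Since $\cosh a$ is a power series in $a^2$ with nonnegative coefficients,
convexity of $x\mapsto x^n$ on $[0,\infty)$ suffices term by term. -/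
lemma cosh_le_of_sq_le {a c r θ : ℝ} (h1 : -1 ≤ θ) (h2 : θ ≤ 1)
    (ha : a ^ 2 ≤ r ^ 2 + c ^ 2 + 2 * r * c * θ) :
    Real.cosh a ≤ Real.cosh r * Real.cosh c + θ * (Real.sinh r * Real.sinh c) := by
  have e : Real.cosh r * Real.cosh c + θ * (Real.sinh r * Real.sinh c) =
      (1 + θ) / 2 * Real.cosh (r + c) + (1 - θ) / 2 * Real.cosh (r - c) := by
    rw [Real.cosh_add, Real.cosh_sub]; ring
  rw [e]
  refine hasSum_le (fun n => ?_) (Real.hasSum_cosh a)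
    (((Real.hasSum_cosh (r + c)).mul_left _).add ((Real.hasSum_cosh (r - c)).mul_left _))
  have hconv : ((1 + θ) / 2 * (r + c) ^ 2 + (1 - θ) / 2 * (r - c) ^ 2) ^ n ≤
      (1 + θ) / 2 * ((r + c) ^ 2) ^ n + (1 - θ) / 2 * ((r - c) ^ 2) ^ n := by
    have h := (convexOn_pow (𝕜 := ℝ) n).2 (Set.mem_Ici.2 (sq_nonneg (r + c)))
      (Set.mem_Ici.2 (sq_nonneg (r - c))) (by linarith : 0 ≤ (1 + θ) / 2)
      (by linarith : 0 ≤ (1 - θ) / 2) (by ring)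
    simpa only [smul_eq_mul] using h
  have h3 : (a ^ 2) ^ n ≤ ((1 + θ) / 2 * (r + c) ^ 2 + (1 - θ) / 2 * (r - c) ^ 2) ^ n := by
    refine pow_le_pow_left₀ (sq_nonneg a) (ha.trans (le_of_eq (by ring))) n
  rw [pow_mul, pow_mul, pow_mul, ← mul_div_assoc, ← mul_div_assoc, ← add_div]
  exact div_le_div_of_nonneg_right (h3.trans hconv) (by positivity)

variable {V : Type*} [NormedAddCommGroup V] [InnerProductSpace ℝ V]

/-- The vector `w` in the bound `cosh ‖s + v‖ ≤ cosh ‖s‖ cosh c + ⟨w, v⟩` for `‖v‖ ≤ c`. -/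
def coshSlope (c : ℝ) (s : V) : V := (Real.sinh ‖s‖ * Real.sinh c / (‖s‖ * c)) • s

/-- The correction is linear in `v`, so it has mean zero when `v` is centered and independent of
`s`. For this reason `θ` divides by `c` rather than by `‖v‖`; Cauchy–Schwarz and `‖v‖ ≤ c` still
give `|θ| ≤ 1`. -/
lemma cosh_norm_add_le {c : ℝ} (hc : 0 < c) (s v : V) (hv : ‖v‖ ≤ c) :
    Real.cosh ‖s + v‖ ≤ Real.cosh ‖s‖ * Real.cosh c + inner ℝ (coshSlope c s) v := by
  rcases eq_or_ne s 0 with rfl | hs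
  · simp [coshSlope, Real.cosh_le_cosh, abs_of_pos hc, hv]
  have hs' : 0 < ‖s‖ := norm_pos_iff.2 hs
  have hsc : 0 < ‖s‖ * c := by positivity
  set θ := inner ℝ s v / (‖s‖ * c) with hθ
  have hin : inner ℝ s v = θ * (‖s‖ * c) := by rw [hθ]; field_simp
  have habs : |inner ℝ s v| ≤ ‖s‖ * c :=
    (abs_real_inner_le_norm s v).trans (mul_le_mul_of_nonneg_left hv hs'.le)
  obtain ⟨hl, hu⟩ := abs_le.1 habs
  have key := cosh_le_of_sq_le (a := ‖s + v‖) (c := c) (r := ‖s‖) (θ := θ)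
    (by rw [hθ, le_div_iff₀ hsc]; linarith) (by rw [hθ, div_le_iff₀ hsc]; linarith)
    (by
      rw [norm_add_sq_real, hin]
      nlinarith [norm_nonneg v])
  refine key.trans (le_of_eq ?_)
  rw [coshSlope, real_inner_smul_left, hin]
  field_simp

lemma norm_coshSlope_le {c : ℝ} (hc : 0 < c) (s : V) :
    ‖coshSlope c s‖ ≤ Real.sinh ‖s‖ * Real.sinh c / c := by
  rcases eq_or_ne s 0 with rfl | hs
  · simp [coshSlope]
  have hs' : 0 < ‖s‖ := norm_pos_iff.2 hs
  have h1 : 0 ≤ Real.sinh ‖s‖ := Real.sinh_nonneg_iff.2 hs'.le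
  have h2 : 0 ≤ Real.sinh c := Real.sinh_nonneg_iff.2 hc.le
  rw [coshSlope, norm_smul, Real.norm_of_nonneg (by positivity)]
  apply le_of_eq
  field_simp

end Hoeffding

/-! ### Exponential and second moment tail bounds for sums of random vectors -/

section Concentration

variable {V : Type*} [NormedAddCommGroup V] [InnerProductSpace ℝ V] [CompleteSpace V]
  {Ω : Type*} [MeasurableSpace Ω] {P : Measure Ω} [IsProbabilityMeasure P]

lemma integrable_inner_of_memLp {α : Type*} [MeasurableSpace α] {ν : Measure α} {f g : α → V}
    (hf : MemLp f 2 ν) (hg : MemLp g 2 ν) : Integrable (fun a => inner ℝ (f a) (g a)) ν := by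
  refine (L2.integrable_inner (𝕜 := ℝ) (hf.toLp f) (hg.toLp g)).congr ?_
  filter_upwards [hf.coeFn_toLp, hg.coeFn_toLp] with a h1 h2
  rw [h1, h2]

lemma aestronglyMeasurable_coshSlope {α : Type*} [MeasurableSpace α] {ν : Measure α} (c : ℝ)
    {S : α → V} (hS : AEStronglyMeasurable S ν) :
    AEStronglyMeasurable (fun a => coshSlope c (S a)) ν := by
  unfold coshSlope
  refine AEStronglyMeasurable.smul (AEMeasurable.aestronglyMeasurable ?_) hS
  have hn : AEMeasurable (fun a => ‖S a‖) ν := hS.norm.aemeasurable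
  exact ((Real.measurable_sinh.comp_aemeasurable hn).mul_const _).div (hn.mul_const _)

/-- Each new summand costs a factor `cosh c`, by `cosh_norm_add_le` and the vanishing of its linear
term. Uniform boundedness makes every integrand integrable. -/
lemma integral_cosh_norm_sum_le {κ Z : Type*} [MeasurableSpace Z] {z : κ → Ω → Z}
    (hz : ∀ k, Measurable (z k)) (hind : iIndepFun z P) {ζ : Z → V} (hζ : StronglyMeasurable ζ)
    {c : ℝ} (hc : 0 < c) (hbound : ∀ w, ‖ζ w‖ ≤ c) (hmean : ∀ k, ∫ ω, ζ (z k ω) ∂P = 0)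
    (s : Finset κ) :
    ∫ ω, Real.cosh ‖∑ k ∈ s, ζ (z k ω)‖ ∂P ≤ Real.cosh c ^ s.card := by
  classical
  have hSm : ∀ s : Finset κ, AEStronglyMeasurable (fun ω => ∑ k ∈ s, ζ (z k ω)) P := fun s =>
    Finset.aestronglyMeasurable_fun_sum s fun k _ =>
      (hζ.comp_measurable (hz k)).aestronglyMeasurable
  have hSb : ∀ (s : Finset κ) ω, ‖∑ k ∈ s, ζ (z k ω)‖ ≤ s.card * c := fun s ω => by
    rw [← nsmul_eq_mul]
    exact norm_sum_le_of_le s (fun k _ => hbound _) |>.trans (by simp)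
  have hci : ∀ s : Finset κ, Integrable (fun ω => Real.cosh ‖∑ k ∈ s, ζ (z k ω)‖) P := fun s => by
    refine Integrable.of_bound
      (Real.continuous_cosh.comp_aestronglyMeasurable (hSm s).norm) (Real.cosh (s.card * c))
      (Filter.Eventually.of_forall fun ω => ?_)
    rw [Real.norm_of_nonneg (Real.cosh_pos _).le, Real.cosh_le_cosh, abs_norm]
    exact (hSb s ω).trans (le_abs_self _)
  induction s using Finset.induction_on with
  | empty => simp
  | insert k s hk ih =>
    have hsum : ∀ ω, ∑ j ∈ insert k s, ζ (z j ω) = ∑ j ∈ s, ζ (z j ω) + ζ (z k ω) := fun ω => by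
      rw [Finset.sum_insert hk, add_comm]
    have hI : IndepFun (fun ω (i : s) => z i ω) (z k) P := by
      have h := hind.indepFun_finset s {k} (Finset.disjoint_singleton_right.2 hk) hz
      exact h.comp measurable_id (measurable_pi_apply (⟨k, by simp⟩ : ({k} : Finset κ)))
    have hXm : Measurable fun ω (i : s) => z i ω := measurable_pi_lambda _ fun i => hz i
    -- The slope is written as a function of the earlier data alone, so that independence from `z k`
    -- factors the expectation of the inner product.
    have hf : Integrable (fun w : s → Z => coshSlope c (∑ i, ζ (w i)))
        (P.map fun ω (i : s) => z i ω) := by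
      refine Integrable.of_bound (aestronglyMeasurable_coshSlope c
        (Finset.aestronglyMeasurable_fun_sum _ fun i _ =>
          (hζ.comp_measurable (measurable_pi_apply i)).aestronglyMeasurable))
        (Real.sinh (s.card * c) * Real.sinh c / c) (Filter.Eventually.of_forall fun w => ?_)
      refine (norm_coshSlope_le hc _).trans ?_
      have h1 : 0 ≤ Real.sinh c := Real.sinh_nonneg_iff.2 hc.le
      have h2 : ‖∑ i, ζ (w i)‖ ≤ s.card * c := by
        refine (norm_sum_le_of_le _ fun i _ => hbound (w i)).trans ?_
        simp
      have h3 := Real.sinh_le_sinh.2 h2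
      gcongr
    have hg : Integrable ζ (P.map (z k)) :=
      Integrable.of_bound hζ.aestronglyMeasurable c (Filter.Eventually.of_forall hbound)
    have hzero : ∫ ω, inner ℝ (coshSlope c (∑ j ∈ s, ζ (z j ω))) (ζ (z k ω)) ∂P = 0 := by
      have h := hI.integral_bilin_comp_comp hXm.aemeasurable (hz k).aemeasurable hf hg (innerSL ℝ)
      rw [hmean k, map_zero] at h
      rw [← h]
      refine integral_congr_ae (Filter.Eventually.of_forall fun ω => ?_)
      beta_reduce
      rw [← Finset.sum_coe_sort s fun j => ζ (z j ω)]
      rfl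
    have hwi : Integrable (fun ω => inner ℝ (coshSlope c (∑ j ∈ s, ζ (z j ω))) (ζ (z k ω))) P := by
      refine Integrable.of_bound ((aestronglyMeasurable_coshSlope c (hSm s)).inner
        (hζ.comp_measurable (hz k)).aestronglyMeasurable)
        (Real.sinh (s.card * c) * Real.sinh c / c * c) (Filter.Eventually.of_forall fun ω => ?_)
      refine (norm_inner_le_norm _ _).trans ?_
      have h1 : 0 ≤ Real.sinh c := Real.sinh_nonneg_iff.2 hc.le
      have h3 := Real.sinh_le_sinh.2 (hSb s ω)
      have h4 : 0 ≤ Real.sinh (s.card * c) := Real.sinh_nonneg_iff.2 (by positivity)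
      refine mul_le_mul ((norm_coshSlope_le hc _).trans ?_) (hbound _) (norm_nonneg _)
        (by positivity)
      gcongr
    calc ∫ ω, Real.cosh ‖∑ j ∈ insert k s, ζ (z j ω)‖ ∂P
        ≤ ∫ ω, (Real.cosh ‖∑ j ∈ s, ζ (z j ω)‖ * Real.cosh c +
            inner ℝ (coshSlope c (∑ j ∈ s, ζ (z j ω))) (ζ (z k ω))) ∂P := by
          refine integral_mono (hci _) (((hci s).mul_const _).add hwi) fun ω => ?_
          simp only [hsum]
          exact cosh_norm_add_le hc _ _ (hbound _)
      _ = (∫ ω, Real.cosh ‖∑ j ∈ s, ζ (z j ω)‖ ∂P) * Real.cosh c := by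
          rw [integral_add ((hci s).mul_const _) hwi, hzero, add_zero, integral_mul_const]
      _ ≤ Real.cosh c ^ (insert k s).card := by
          rw [Finset.card_insert_of_notMem hk, pow_succ]
          exact mul_le_mul_of_nonneg_right ih (Real.cosh_pos _).le

/-- **Hoeffding's inequality in Hilbert space**, with Pinelis' constant. -/
lemma measureReal_norm_sum_le {m : ℕ} (hm : 1 ≤ m) {Z : Type*} [MeasurableSpace Z]
    {z : Fin m → Ω → Z} (hz : ∀ k, Measurable (z k)) (hind : iIndepFun z P) {ζ : Z → V}
    (hζ : StronglyMeasurable ζ) {c : ℝ} (hc : 0 < c) (hbound : ∀ w, ‖ζ w‖ ≤ c)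
    (hmean : ∀ k, ∫ ω, ζ (z k ω) ∂P = 0) {r : ℝ} (hr : 0 < r) :
    P.real {ω | r < ‖∑ k, ζ (z k ω)‖} ≤ 2 * Real.exp (-(r ^ 2 / (2 * m * c ^ 2))) := by
  have hm' : (0 : ℝ) < m := by exact_mod_cast hm
  -- Minimizer of the Chernoff exponent $m(lc)^2/2-lr$, with value $-r^2/(2mc^2)$.
  set l : ℝ := r / (m * c ^ 2) with hl
  have hl0 : 0 < l := by positivity
  have hb' : ∀ w, ‖l • ζ w‖ ≤ l * c := fun w => by
    rw [norm_smul, Real.norm_of_nonneg hl0.le]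
    exact mul_le_mul_of_nonneg_left (hbound w) hl0.le
  have hE := integral_cosh_norm_sum_le hz hind (hζ.const_smul l) (mul_pos hl0 hc) hb'
    (fun k => by
      have := hmean k
      simp only [Pi.smul_apply]
      rw [integral_smul, this, smul_zero]) Finset.univ
  have hn : ∀ ω, ‖∑ k, (l • ζ) (z k ω)‖ = l * ‖∑ k, ζ (z k ω)‖ := fun ω => by
    simp only [Pi.smul_apply]
    rw [← Finset.smul_sum, norm_smul, Real.norm_of_nonneg hl0.le]
  simp only [hn, Finset.card_univ, Fintype.card_fin] at hE
  have hSm : AEStronglyMeasurable (fun ω => ∑ k, ζ (z k ω)) P :=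
    Finset.aestronglyMeasurable_fun_sum _ fun k _ =>
      (hζ.comp_measurable (hz k)).aestronglyMeasurable
  have hSb : ∀ ω, ‖∑ k, ζ (z k ω)‖ ≤ m * c := fun ω => by
    refine (norm_sum_le_of_le _ fun k _ => hbound (z k ω)).trans ?_
    simp
  have hci : Integrable (fun ω => Real.cosh (l * ‖∑ k, ζ (z k ω)‖)) P := by
    refine Integrable.of_bound
      (Real.continuous_cosh.comp_aestronglyMeasurable (hSm.norm.const_mul l))
      (Real.cosh (l * (m * c))) (Filter.Eventually.of_forall fun ω => ?_)
    rw [Real.norm_of_nonneg (Real.cosh_pos _).le, Real.cosh_le_cosh,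
      abs_of_nonneg (by positivity), abs_of_nonneg (by positivity)]
    exact mul_le_mul_of_nonneg_left (hSb ω) hl0.le
  have hM := mul_meas_ge_le_integral_of_nonneg
    (Filter.Eventually.of_forall fun ω => (Real.cosh_pos (l * ‖∑ k, ζ (z k ω)‖)).le) hci
    (Real.cosh (l * r))
  have hsub : P.real {ω | r < ‖∑ k, ζ (z k ω)‖} ≤
      P.real {ω | Real.cosh (l * r) ≤ Real.cosh (l * ‖∑ k, ζ (z k ω)‖)} := by
    refine measureReal_mono fun ω hω => ?_
    change r < _ at hω
    change Real.cosh _ ≤ Real.cosh _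
    rw [Real.cosh_le_cosh, abs_of_nonneg (by positivity), abs_of_nonneg (by positivity)]
    exact mul_le_mul_of_nonneg_left hω.le hl0.le
  -- This half is the source of the factor 2 in the tail bound.
  have hcosh : Real.exp (l * r) / 2 ≤ Real.cosh (l * r) := by
    rw [Real.cosh_eq]
    have := Real.exp_pos (-(l * r))
    linarith
  have hpow : Real.cosh (l * c) ^ m ≤ Real.exp (m * ((l * c) ^ 2 / 2)) := by
    rw [Real.exp_nat_mul]
    exact pow_le_pow_left₀ (Real.cosh_pos _).le (Real.cosh_le_exp_half_sq _) m
  have hfin : Real.exp (l * r) / 2 * P.real {ω | r < ‖∑ k, ζ (z k ω)‖} ≤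
      Real.exp (m * ((l * c) ^ 2 / 2)) :=
    (mul_le_mul hcosh hsub measureReal_nonneg (Real.cosh_pos _).le).trans
      (hM.trans (hE.trans hpow))
  have hexp : Real.exp (-(r ^ 2 / (2 * m * c ^ 2))) =
      Real.exp (m * ((l * c) ^ 2 / 2)) / Real.exp (l * r) := by
    rw [← Real.exp_sub]
    congr 1
    rw [hl]
    field_simp
    ring
  rw [hexp, ← mul_div_assoc, le_div_iff₀ (Real.exp_pos _)]
  linarith

/-- Chebyshev's inequality for an average of square integrable vectors. -/
lemma measureReal_norm_average_le {m : ℕ} (hm : 1 ≤ m) {ξ : Fin m → Ω → V}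
    (hξ : ∀ k, MemLp (ξ k) 2 P) {ε : ℝ} (hε : 0 < ε) :
    P.real {ω | ε < ‖(m : ℝ)⁻¹ • ∑ k, ξ k ω‖} ≤
      (∑ k, ∑ l, ∫ ω, inner ℝ (ξ k ω) (ξ l ω) ∂P) / (m * ε) ^ 2 := by
  have hm' : (0 : ℝ) < m := by exact_mod_cast hm
  have hi : ∀ k l, Integrable (fun ω => inner ℝ (ξ k ω) (ξ l ω)) P := fun k l =>
    integrable_inner_of_memLp (hξ k) (hξ l)
  have hsq : ∀ ω, ‖∑ k, ξ k ω‖ ^ 2 = ∑ k, ∑ l, inner ℝ (ξ k ω) (ξ l ω) := fun ω => by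
    rw [← real_inner_self_eq_norm_sq, sum_inner]
    exact Finset.sum_congr rfl fun k _ => inner_sum _ _ _
  have hint : Integrable (fun ω => ‖∑ k, ξ k ω‖ ^ 2) P := by
    simp only [hsq]
    exact integrable_finsetSum _ fun k _ => integrable_finsetSum _ fun l _ => hi k l
  have hM := mul_meas_ge_le_integral_of_nonneg
    (Filter.Eventually.of_forall fun ω => sq_nonneg ‖∑ k, ξ k ω‖) hint ((m * ε) ^ 2)
  have heq : ∫ ω, ‖∑ k, ξ k ω‖ ^ 2 ∂P = ∑ k, ∑ l, ∫ ω, inner ℝ (ξ k ω) (ξ l ω) ∂P := by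
    simp only [hsq]
    rw [integral_finsetSum _ fun k _ => integrable_finsetSum _ fun l _ => hi k l]
    exact Finset.sum_congr rfl fun k _ => integral_finsetSum _ fun l _ => hi k l
  rw [le_div_iff₀ (by positivity), ← heq, mul_comm]
  refine (mul_le_mul_of_nonneg_left (measureReal_mono fun ω hω => ?_) (by positivity)).trans hM
  change ε < _ at hω
  change (m * ε) ^ 2 ≤ _
  rw [norm_smul, norm_inv, Real.norm_of_nonneg hm'.le, lt_inv_mul_iff₀ hm'] at hω
  exact pow_le_pow_left₀ (by positivity) hω.le 2

lemma integral_inner_eq_zero_of_indepFun {Z : Type*} [MeasurableSpace Z] {X Y : Ω → Z}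
    (hX : Measurable X) (hY : Measurable Y) (hXY : IndepFun X Y P) {ζ : Z → V}
    (hζX : Integrable ζ (P.map X)) (hζY : Integrable ζ (P.map Y))
    (hmean : ∫ ω, ζ (Y ω) ∂P = 0) : ∫ ω, inner ℝ (ζ (X ω)) (ζ (Y ω)) ∂P = 0 := by
  have h := hXY.integral_bilin_comp_comp hX.aemeasurable hY.aemeasurable hζX hζY (innerSL ℝ)
  rwa [hmean, map_zero] at h

end Concentration

/-! ### The joint law of two consecutive states -/

section JointLaw

variable {X : Type*} [MeasurableSpace X] {κ : Kernel X X} [IsMarkovKernel κ]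
  {μ : Measure X} [IsProbabilityMeasure μ]

variable (κ μ) in
lemma measurePreserving_fst : MeasurePreserving Prod.fst (μ ⊗ₘ κ) μ :=
  ⟨measurable_fst, Measure.fst_compProd μ κ⟩

lemma measurePreserving_snd (h : κ.Invariant μ) : MeasurePreserving Prod.snd (μ ⊗ₘ κ) μ :=
  ⟨measurable_snd, (Measure.snd_compProd μ κ).trans h.def⟩

lemma koopman_coeFn (h : κ.Invariant μ) (ψ : Lp ℝ 2 μ) :
    koopman h ψ =ᵐ[μ] fun x => ∫ y, ψ y ∂κ x := by
  rw [koopman_apply]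
  exact (memLp_koopman h ψ).coeFn_toLp

lemma integrable_fst_mul_snd (h : κ.Invariant μ) {u v : X → ℝ} (hu : MemLp u 2 μ)
    (hv : MemLp v 2 μ) : Integrable (fun z : X × X => u z.1 * v z.2) (μ ⊗ₘ κ) :=
  (hu.comp_measurePreserving (measurePreserving_fst κ μ)).integrable_mul
    (hv.comp_measurePreserving (measurePreserving_snd h))

/-- Integrating out `y` first replaces `v(y)` by `K v(x)`. The moments under the joint law that
define $C^t_{\mathbb H}$, `K` and its adjoint are all read off from this identity. -/
lemma integral_fst_mul_snd (h : κ.Invariant μ) {u v : X → ℝ} (hu : MemLp u 2 μ)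
    (hv : MemLp v 2 μ) : ∫ z, u z.1 * v z.2 ∂(μ ⊗ₘ κ) =
      inner ℝ (hu.toLp u) (koopman h (hv.toLp v)) := by
  rw [Measure.integral_compProd (integrable_fst_mul_snd h hu hv), L2.inner_def]
  refine integral_congr_ae ?_
  filter_upwards [hu.coeFn_toLp, koopman_coeFn h (hv.toLp v), ae_ae_kernel h hv.coeFn_toLp]
    with x h1 h2 h3
  rw [h1, h2, integral_const_mul, integral_congr_ae h3]
  simp [mul_comm]

end JointLaw

/-! ### The rank-one matrices of the data -/

section PairVec

variable {X : Type*} (H : Type*) [NormedAddCommGroup H] [InnerProductSpace ℝ H]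
  [CompleteSpace H] [RKHS ℝ H X ℝ] {ι : Type*} (b : HilbertBasis ι ℝ H)

variable {H} in
/-- The matrix of the rank-one operator `C_{xy}`, where `z = (x, y)`. -/
def pairVec (z : X × X) : lp (fun _ : ι × ι => ℝ) 2 :=
  rankOneMatrix b (feature H z.1) (feature H z.2)

variable {H}

lemma pairVec_apply (z : X × X) (p : ι × ι) :
    pairVec b z p = b p.2 z.1 * b p.1 z.2 := by
  rw [pairVec, rankOneMatrix_apply, real_inner_comm, inner_feature, real_inner_comm, inner_feature]

lemma norm_pairVec_sq (z : X × X) : ‖pairVec b z‖ ^ 2 = kdiag H z.1 * kdiag H z.2 := by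
  rw [pairVec, norm_rankOneMatrix, mul_pow, norm_feature_sq, norm_feature_sq]

lemma pairVec_apply_eq_inner (x y : X) (p : ι × ι) :
    pairVec b (x, y) p = inner ℝ (b p.2) (rankOneOp H x y (b p.1)) := by
  rw [pairVec_apply, rankOneOp_apply, real_inner_smul_right, real_inner_comm, inner_feature,
    mul_comm]

variable [TopologicalSpace X] [MeasurableSpace X] [SecondCountableTopology X] [BorelSpace X]
  {μ : Measure X} [IsProbabilityMeasure μ] {κ : Kernel X X} [IsMarkovKernel κ]

lemma stronglyMeasurable_pairVec (hc : Compatible H μ) :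
    StronglyMeasurable (pairVec b : X × X → lp (fun _ : ι × ι => ℝ) 2) := by
  have h1 : Continuous fun z : X × X => feature H z.1 := hc.continuous_feature.comp continuous_fst
  have h2 : Continuous fun z : X × X => feature H z.2 := hc.continuous_feature.comp continuous_snd
  exact (((rankOneMatrix b).continuous.comp h1).clm_apply h2).stronglyMeasurable

lemma memLp_pairVec (hc : Compatible H μ) (h : κ.Invariant μ) :
    MemLp (pairVec b : X × X → _) 2 (μ ⊗ₘ κ) := by
  rw [memLp_two_iff_integrable_sq_norm (stronglyMeasurable_pairVec b hc).aestronglyMeasurable]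
  simp only [norm_pairVec_sq]
  exact integrable_fst_mul_snd h hc.memLp_diag hc.memLp_diag

lemma integral_norm_pairVec_sq (hc : Compatible H μ) (h : κ.Invariant μ) :
    ∫ z, ‖pairVec b z‖ ^ 2 ∂(μ ⊗ₘ κ) =
    inner ℝ (koopman h (hc.memLp_diag.toLp (kdiag H))) (hc.memLp_diag.toLp (kdiag H)) := by
  simp only [norm_pairVec_sq]
  rw [integral_fst_mul_snd h hc.memLp_diag hc.memLp_diag, real_inner_comm]

lemma integral_pairVec_apply (hc : Compatible H μ) (h : κ.Invariant μ) (p : ι × ι) :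
    (∫ z, pairVec b z ∂(μ ⊗ₘ κ) : lp (fun _ : ι × ι => ℝ) 2) p =
      ∫ z, b p.2 z.1 * b p.1 z.2 ∂(μ ⊗ₘ κ) := by
  have h1 := (lp.evalCLM ℝ (fun _ : ι × ι => ℝ) 2 p).integral_comp_comm
    ((memLp_pairVec b hc h).integrable one_le_two)
  simp only [← pairVec_apply]
  exact h1.symm

/-- The estimator is unbiased: both sides are $\langle f_j,Kf_i\rangle_\mu$ for the basis functions
$f_i$, $f_j$, the right one because `incl` is adjoint to `embed`. -/
lemma integral_pairVec_apply_eq_inner (hc : Compatible H μ) (h : κ.Invariant μ) (p : ι × ι) :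
    (∫ z, pairVec b z ∂(μ ⊗ₘ κ) : lp (fun _ : ι × ι => ℝ) 2) p =
      inner ℝ (b p.2) (crossCov hc h (b p.1)) := by
  rw [integral_pairVec_apply b hc h, integral_fst_mul_snd h (hc.memLp_coe _) (hc.memLp_coe _)]
  change _ = inner ℝ (b p.2) (embed hc (koopman h (incl hc (b p.1))))
  rw [real_inner_comm _ (b p.2), inner_embed, real_inner_comm]
  rfl

/-- Being the norm of an actual vector, the value is finite, so $C^t_{\mathbb H}$ is
Hilbert–Schmidt. -/
lemma hsNorm_crossCov (hc : Compatible H μ) (h : κ.Invariant μ) :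
    hsNorm (crossCov hc h) = ‖∫ z, pairVec b z ∂(μ ⊗ₘ κ)‖ₑ :=
  hsNorm_eq_enorm b _ _ (integral_pairVec_apply_eq_inner b hc h)

variable (μ κ) in
/-- The matrix of `C_{xy} - C`, where `z = (x, y)`. -/
def centeredVec (z : X × X) : lp (fun _ : ι × ι => ℝ) 2 :=
  pairVec b z - ∫ w, pairVec b w ∂(μ ⊗ₘ κ)

lemma stronglyMeasurable_centeredVec (hc : Compatible H μ) :
    StronglyMeasurable (centeredVec b μ κ : X × X → _) :=
  (stronglyMeasurable_pairVec b hc).sub stronglyMeasurable_const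

lemma memLp_centeredVec (hc : Compatible H μ) (h : κ.Invariant μ) :
    MemLp (centeredVec b μ κ : X × X → _) 2 (μ ⊗ₘ κ) :=
  (memLp_pairVec b hc h).sub (memLp_const _)

lemma integral_centeredVec (hc : Compatible H μ) (h : κ.Invariant μ) :
    ∫ z, centeredVec b μ κ z ∂(μ ⊗ₘ κ) = 0 := by
  unfold centeredVec
  rw [integral_sub ((memLp_pairVec b hc h).integrable one_le_two) (integrable_const _)]
  simp

/-- Variance as second moment minus squared norm of the mean: the former is $\langle
K\varphi,\varphi\rangle_\mu$, the latter $\|C^t_{\mathbb H}\|_{HS}^2$. -/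
lemma integral_norm_centeredVec_sq (hc : Compatible H μ) (h : κ.Invariant μ) :
    ∫ z, ‖centeredVec b μ κ z‖ ^ 2 ∂(μ ⊗ₘ κ) = E0 hc h := by
  have hi := memLp_pairVec b hc h
  have hi1 := hi.integrable one_le_two
  have hi2 : Integrable (fun z => ‖pairVec b z‖ ^ 2) (μ ⊗ₘ κ) :=
    (memLp_two_iff_integrable_sq_norm hi.1).1 hi
  have hinner := integral_inner (𝕜 := ℝ) hi1 (∫ w, pairVec b w ∂(μ ⊗ₘ κ))
  rw [real_inner_self_eq_norm_sq] at hinner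
  have e : ∀ z, ‖centeredVec b μ κ z‖ ^ 2 = ‖pairVec b z‖ ^ 2 -
      2 * inner ℝ (∫ w, pairVec b w ∂(μ ⊗ₘ κ)) (pairVec b z) +
        ‖∫ w, pairVec b w ∂(μ ⊗ₘ κ)‖ ^ 2 := fun z => by
    rw [centeredVec, norm_sub_sq_real, real_inner_comm]
  simp only [e]
  have hi3 := (hi1.const_inner (𝕜 := ℝ) (∫ w, pairVec b w ∂(μ ⊗ₘ κ))).const_mul 2
  have hi4 : Integrable (fun z => ‖pairVec b z‖ ^ 2 -
      2 * inner ℝ (∫ w, pairVec b w ∂(μ ⊗ₘ κ)) (pairVec b z)) (μ ⊗ₘ κ) := hi2.sub hi3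
  rw [integral_add hi4 (integrable_const _), integral_sub hi2 hi3,
    integral_const_mul, hinner, integral_norm_pairVec_sq b hc h, E0, hsNorm_crossCov b hc h,
    toReal_enorm]
  simp
  ring

lemma hsNorm_crossCov_sub_empirical (hc : Compatible H μ) (h : κ.Invariant μ) {m : ℕ}
    (hm : 1 ≤ m) (x y : Fin m → X) : hsNorm (crossCov hc h - empirical H x y) =
      ‖(m : ℝ)⁻¹ • ∑ k, centeredVec b μ κ (x k, y k)‖ₑ := by
  have hm' : (m : ℝ) ≠ 0 := by exact_mod_cast (by omega : m ≠ 0)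
  have e : (m : ℝ)⁻¹ • ∑ k, centeredVec b μ κ (x k, y k) =
      -((∫ w, pairVec b w ∂(μ ⊗ₘ κ)) - (m : ℝ)⁻¹ • ∑ k, pairVec b (x k, y k)) := by
    simp only [centeredVec, Finset.sum_sub_distrib, Finset.sum_const, Finset.card_univ,
      Fintype.card_fin, smul_sub, ← Nat.cast_smul_eq_nsmul ℝ m, smul_smul, inv_mul_cancel₀ hm',
      one_smul, neg_sub]
  rw [e, enorm_neg]
  refine hsNorm_eq_enorm b _ _ fun p => ?_
  have h1 : (∑ k, pairVec b (x k, y k) : lp (fun _ : ι × ι => ℝ) 2) p =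
      ∑ k, pairVec b (x k, y k) p := by
    rw [lp.coeFn_sum, Finset.sum_apply]
  rw [lp.coeFn_sub, Pi.sub_apply, lp.coeFn_smul, Pi.smul_apply, h1,
    integral_pairVec_apply_eq_inner b hc h]
  simp only [pairVec_apply_eq_inner, empirical, sub_apply, smul_apply, sum_apply, inner_sub_right,
    inner_smul_right, inner_sum, smul_eq_mul]

variable {Ω : Type*} [MeasurableSpace Ω] {P : Measure Ω} [IsProbabilityMeasure P]

/-- A tail bound for the average of the centered rank-one matrices bounds the deviation of the
estimator in Hilbert-Schmidt norm and at each unit vector. -/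
lemma measureReal_deviation_le (hc : Compatible H μ) (h : κ.Invariant μ) {m : ℕ} (hm : 1 ≤ m)
    (x y : Fin m → Ω → X) {ε : ℝ} (hε : 0 < ε) {B : ℝ}
    (hB : P.real {ω | ε < ‖(m : ℝ)⁻¹ • ∑ k, centeredVec b μ κ (x k ω, y k ω)‖} ≤ B) :
    P.real {ω | ENNReal.ofReal ε < hsNorm (crossCov hc h -
        empirical H (fun k => x k ω) (fun k => y k ω))} ≤ B ∧
      ∀ ψ : H, ‖ψ‖ = 1 → P.real {ω | ε < ‖embed hc (koopman h (incl hc ψ)) -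
        empirical H (fun k => x k ω) (fun k => y k ω) ψ‖} ≤ B := by
  have e : {ω | ENNReal.ofReal ε < hsNorm (crossCov hc h -
        empirical H (fun k => x k ω) (fun k => y k ω))} =
      {ω | ε < ‖(m : ℝ)⁻¹ • ∑ k, centeredVec b μ κ (x k ω, y k ω)‖} := by
    ext ω
    simp only [Set.mem_ofPred_eq]
    rw [hsNorm_crossCov_sub_empirical b hc h hm, ← ofReal_norm,
      ENNReal.ofReal_lt_ofReal_iff_of_nonneg hε.le]
  have h1 : P.real {ω | ENNReal.ofReal ε < hsNorm (crossCov hc h -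
        empirical H (fun k => x k ω) (fun k => y k ω))} ≤ B := by rwa [e]
  refine ⟨h1, fun ψ hψ => (measureReal_mono fun ω hω => ?_).trans h1⟩
  simp only [Set.mem_ofPred_eq] at hω ⊢
  refine lt_of_lt_of_le ?_ (enorm_apply_le_hsNorm _ hψ)
  rw [← ofReal_norm]
  exact (ENNReal.ofReal_lt_ofReal_iff_of_nonneg hε.le).2 hω

end PairVec

/-! ### Independent samples -/

section IID

variable {X : Type*} {H : Type*} [NormedAddCommGroup H] [InnerProductSpace ℝ H]
  [CompleteSpace H] [RKHS ℝ H X ℝ] {ι : Type*} (b : HilbertBasis ι ℝ H)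
  [TopologicalSpace X] [MeasurableSpace X] [SecondCountableTopology X] [BorelSpace X]
  {μ : Measure X} [IsProbabilityMeasure μ] {κ : Kernel X X} [IsMarkovKernel κ]
  {Ω : Type*} [MeasurableSpace Ω] {P : Measure Ω} [IsProbabilityMeasure P]

lemma IsIIDSample.measurePreserving {m : ℕ} {x y : Fin m → Ω → X}
    (hs : IsIIDSample κ μ P x y) (k : Fin m) :
    MeasurePreserving (fun ω => (x k ω, y k ω)) P (μ ⊗ₘ κ) :=
  ⟨(hs.measurable_fst k).prodMk (hs.measurable_snd k), hs.map_pair k⟩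

lemma integral_comp_of_measurePreserving {α β E : Type*} [MeasurableSpace α] [MeasurableSpace β]
    [NormedAddCommGroup E] [NormedSpace ℝ E] {ν : Measure α} {ν' : Measure β} {T : α → β}
    (hT : MeasurePreserving T ν ν') {g : β → E} (hg : AEStronglyMeasurable g ν') :
    ∫ a, g (T a) ∂ν = ∫ b, g b ∂ν' := by
  rw [← hT.map_eq] at hg ⊢
  exact (integral_map hT.measurable.aemeasurable hg).symm

lemma IsIIDSample.measureReal_average_le (hc : Compatible H μ) (h : κ.Invariant μ) {m : ℕ}
    (hm : 1 ≤ m) {x y : Fin m → Ω → X} (hs : IsIIDSample κ μ P x y) {ε : ℝ} (hε : 0 < ε) :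
    P.real {ω | ε < ‖(m : ℝ)⁻¹ • ∑ k, centeredVec b μ κ (x k ω, y k ω)‖} ≤
      E0 hc h / (m * ε ^ 2) := by
  have hm' : (0 : ℝ) < m := by exact_mod_cast hm
  have hζ := memLp_centeredVec b hc h
  have hmp := hs.measurePreserving
  refine (measureReal_norm_average_le hm
    (fun k => hζ.comp_measurePreserving (hmp k)) hε).trans (le_of_eq ?_)
  have hd : ∀ k, ∫ ω, inner ℝ (centeredVec b μ κ (x k ω, y k ω))
      (centeredVec b μ κ (x k ω, y k ω)) ∂P = E0 hc h := fun k => by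
    simp only [real_inner_self_eq_norm_sq]
    rw [← integral_norm_centeredVec_sq b hc h]
    exact integral_comp_of_measurePreserving (hmp k) (hζ.1.norm.pow 2)
  -- Independence and centering remove the cross terms, leaving `m` copies of `E0` over
  -- $(m\varepsilon)^2$.
  have ho : ∀ k l, l ≠ k → ∫ ω, inner ℝ (centeredVec b μ κ (x k ω, y k ω))
      (centeredVec b μ κ (x l ω, y l ω)) ∂P = 0 := fun k l hkl => by
    have hi : ∀ k, Integrable (centeredVec b μ κ) (P.map fun ω => (x k ω, y k ω)) := fun k => by
      rw [hs.map_pair k]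
      exact hζ.integrable one_le_two
    refine integral_inner_eq_zero_of_indepFun (hmp k).measurable (hmp l).measurable
      (hs.indep.indepFun hkl.symm) (hi k) (hi l) ?_
    rw [integral_comp_of_measurePreserving (hmp l) hζ.1, integral_centeredVec b hc h]
  have hsum : ∀ k, ∑ l, ∫ ω, inner ℝ (centeredVec b μ κ (x k ω, y k ω))
      (centeredVec b μ κ (x l ω, y l ω)) ∂P = E0 hc h := fun k => by
    rw [Finset.sum_eq_single k (fun l _ hl => ho k l hl) (by simp), hd]
  simp only [Function.comp_apply, hsum, Finset.sum_const, Finset.card_univ, Fintype.card_fin,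
    nsmul_eq_mul]
  field_simp

lemma norm_pairVec_le (hk : IsBoundedKernel H) (z : X × X) :
    ‖pairVec b z‖ ≤ kernelSup H := by
  have h1 : ∀ x : X, ‖feature H x‖ ^ 2 ≤ kernelSup H := fun x => by
    rw [norm_feature_sq, kdiag]
    exact (le_abs_self _).trans (le_ciSup hk (x, x))
  rw [pairVec, norm_rankOneMatrix]
  -- Arithmetic–geometric mean: the product of the two feature norms is at most half the sum of
  -- their squares.
  nlinarith [h1 z.1, h1 z.2, sq_nonneg (‖feature H z.1‖ - ‖feature H z.2‖)]

lemma norm_centeredVec_le (hk : IsBoundedKernel H) (z : X × X) :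
    ‖centeredVec b μ κ z‖ ≤ 2 * kernelSup H := by
  have h1 : ‖∫ w, pairVec b w ∂(μ ⊗ₘ κ)‖ ≤ kernelSup H := by
    refine (norm_integral_le_of_norm_le_const
      (Filter.Eventually.of_forall (norm_pairVec_le b hk))).trans ?_
    simp
  refine (norm_sub_le _ _).trans ?_
  linarith [norm_pairVec_le b hk z]

lemma IsIIDSample.measureReal_average_le_exp (hc : Compatible H μ) (h : κ.Invariant μ) {m : ℕ}
    (hm : 1 ≤ m) {x y : Fin m → Ω → X} (hs : IsIIDSample κ μ P x y) (hk : IsBoundedKernel H)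
    {ε : ℝ} (hε : 0 < ε) :
    P.real {ω | ε < ‖(m : ℝ)⁻¹ • ∑ k, centeredVec b μ κ (x k ω, y k ω)‖} ≤
      2 * Real.exp (-(m * ε ^ 2 / (8 * kernelSup H ^ 2))) := by
  have hm' : (0 : ℝ) < m := by exact_mod_cast hm
  have h0 : 0 ≤ kernelSup H := Real.iSup_nonneg fun _ => abs_nonneg _
  -- If the supremum is `0`, division by zero makes the exponent `0`, and the bound `2` is trivial.
  rcases h0.eq_or_lt with h0 | h0
  · rw [← h0]
    simp only [ne_eq, OfNat.ofNat_ne_zero, not_false_eq_true, zero_pow, mul_zero, div_zero,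
      neg_zero, Real.exp_zero, mul_one]
    exact measureReal_le_one.trans one_le_two
  have hζ := memLp_centeredVec b hc h
  have hmp := hs.measurePreserving
  -- With radius $c=2\|k\|_\infty$ and $r=m\varepsilon$, the exponent $r^2/(2mc^2)$ equals
  -- $m\varepsilon^2/(8\|k\|_\infty^2)$.
  have hH := measureReal_norm_sum_le hm (fun k => (hmp k).measurable) hs.indep
    (stronglyMeasurable_centeredVec b (κ := κ) hc) (by linarith : 0 < 2 * kernelSup H)
    (norm_centeredVec_le b hk)
    (fun k => by rw [integral_comp_of_measurePreserving (hmp k) hζ.1, integral_centeredVec b hc h])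
    (mul_pos hm' hε)
  have e : {ω | ε < ‖(m : ℝ)⁻¹ • ∑ k, centeredVec b μ κ (x k ω, y k ω)‖} =
      {ω | m * ε < ‖∑ k, centeredVec b μ κ (x k ω, y k ω)‖} := by
    ext ω
    simp only [Set.mem_ofPred_eq]
    rw [norm_smul, norm_inv, Real.norm_of_nonneg hm'.le, lt_inv_mul_iff₀ hm']
  rw [e]
  refine hH.trans (le_of_eq ?_)
  congr 3
  field_simp
  ring

end IID

/-! ### Conditioning on a measure preserving map -/

section Conditioning

variable {α β : Type*} [MeasurableSpace α] [mβ : MeasurableSpace β] {ν : Measure α} {μ : Measure β}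
  [IsProbabilityMeasure ν] {T : α → β} {f : α → ℝ} {u : β → ℝ}

/-- The sets `T ⁻¹' A` are exactly the events of the σ-algebra generated by `T`, so `hfu` is the
defining property of the conditional expectation of `f` given `T`. -/
lemma comp_ae_eq_condExp_comap (hT : MeasurePreserving T ν μ) (hf : Integrable f ν)
    (hu : Integrable u μ) (hum : StronglyMeasurable u)
    (hfu : ∀ A, MeasurableSet A → ∫ a in T ⁻¹' A, f a ∂ν = ∫ b in A, u b ∂μ) :
    u ∘ T =ᵐ[ν] ν[f | mβ.comap T] := by
  refine ae_eq_condExp_of_forall_setIntegral_eq hT.measurable.comap_le hf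
    (fun s _ _ => (hT.integrable_comp_of_integrable hu).integrableOn) ?_
    (hum.comp_measurable (comap_measurable T)).aestronglyMeasurable
  rintro s ⟨A, hA, rfl⟩ -
  rw [hfu A hA]
  have h1 := setIntegral_map (μ := ν) (g := T) (f := u) hA
    (by rw [hT.map_eq]; exact hu.1) hT.measurable.aemeasurable
  rw [hT.map_eq] at h1
  exact h1.symm

lemma mul_comp_ae_eq_condExp_comap (hT : MeasurePreserving T ν μ) (hf : Integrable f ν)
    (hu : Integrable u μ) (hum : StronglyMeasurable u)
    (hfu : ∀ A, MeasurableSet A → ∫ a in T ⁻¹' A, f a ∂ν = ∫ b in A, u b ∂μ)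
    {g : β → ℝ} (hg : StronglyMeasurable g) (hgf : Integrable (fun a => g (T a) * f a) ν) :
    (fun b => g b * u b) ∘ T =ᵐ[ν] ν[fun a => g (T a) * f a | mβ.comap T] := by
  have h1 := condExp_mul_of_stronglyMeasurable_left (m := mβ.comap T) (μ := ν)
    (hg.comp_measurable (comap_measurable T)) hgf hf
  filter_upwards [h1, comp_ae_eq_condExp_comap hT hf hu hum hfu] with a h2 h3
  rw [show (fun a => g (T a) * f a) = g ∘ T * f from rfl, h2, Pi.mul_apply, ← h3]
  rfl

/-- Pulling out the known factor makes `g * u` a conditional expectation of `g(T) f`, and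
conditional expectation contracts $L^2$. Integrability of `g * u` is a consequence, not an
assumption. -/
lemma eLpNorm_mul_le_of_setIntegral_eq (hT : MeasurePreserving T ν μ) (hf : Integrable f ν)
    (hu : Integrable u μ) (hum : StronglyMeasurable u)
    (hfu : ∀ A, MeasurableSet A → ∫ a in T ⁻¹' A, f a ∂ν = ∫ b in A, u b ∂μ)
    {g : β → ℝ} (hg : StronglyMeasurable g) (hgf : Integrable (fun a => g (T a) * f a) ν) :
    eLpNorm (fun b => g b * u b) 2 μ ≤ eLpNorm (fun a => g (T a) * f a) 2 ν := by
  rw [← eLpNorm_comp_measurePreserving (g := fun b => g b * u b)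
    (hg.mul hum).aestronglyMeasurable hT,
    eLpNorm_congr_ae (mul_comp_ae_eq_condExp_comap hT hf hu hum hfu hg hgf)]
  exact eLpNorm_condExp_le_eLpNorm _ one_le_two

lemma integral_mul_eq_of_setIntegral_eq (hT : MeasurePreserving T ν μ) (hf : Integrable f ν)
    (hu : Integrable u μ) (hum : StronglyMeasurable u)
    (hfu : ∀ A, MeasurableSet A → ∫ a in T ⁻¹' A, f a ∂ν = ∫ b in A, u b ∂μ)
    {g : β → ℝ} (hg : StronglyMeasurable g) (hgf : Integrable (fun a => g (T a) * f a) ν) :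
    ∫ a, g (T a) * f a ∂ν = ∫ b, g b * u b ∂μ := by
  rw [← integral_comp_of_measurePreserving (g := fun b => g b * u b) hT
    (hg.mul hum).aestronglyMeasurable]
  exact (integral_condExp hT.measurable.comap_le).symm.trans
    (integral_congr_ae (mul_comp_ae_eq_condExp_comap hT hf hu hum hfu hg hgf).symm)

end Conditioning

/-! ### The Koopman operator and its adjoint as conditional expectations -/

section KoopmanConditioning

variable {X : Type*} [MeasurableSpace X] {κ : Kernel X X} [IsMarkovKernel κ]
  {μ : Measure X} [IsProbabilityMeasure μ]

lemma oneL2_coeFn : oneL2 μ =ᵐ[μ] fun _ => (1 : ℝ) := MemLp.coeFn_toLp _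

lemma memLp_indicator_one {A : Set X} (hA : MeasurableSet A) :
    MemLp (A.indicator fun _ => (1 : ℝ)) 2 μ := (memLp_const 1).indicator hA

lemma inner_toLp_indicator {A : Set X} (hA : MeasurableSet A) (ψ : Lp ℝ 2 μ) :
    inner ℝ ((memLp_indicator_one (μ := μ) hA).toLp _) ψ = ∫ x in A, ψ x ∂μ := by
  rw [L2.inner_def, ← integral_indicator hA]
  refine integral_congr_ae ?_
  filter_upwards [(memLp_indicator_one (μ := μ) hA).coeFn_toLp] with x hx
  rw [hx]
  by_cases h : x ∈ A <;> simp [h]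

/-- `K v` is the conditional expectation of `v(y)` given `x`. -/
lemma setIntegral_snd_eq (h : κ.Invariant μ) {v : X → ℝ} (hv : MemLp v 2 μ) {A : Set X}
    (hA : MeasurableSet A) :
    ∫ z in Prod.fst ⁻¹' A, v z.2 ∂(μ ⊗ₘ κ) = ∫ x in A, koopman h (hv.toLp v) x ∂μ := by
  rw [← inner_toLp_indicator hA, ← integral_fst_mul_snd h (memLp_indicator_one hA) hv,
    ← integral_indicator (measurable_fst hA)]
  refine integral_congr_ae (Filter.Eventually.of_forall fun z => ?_)
  by_cases hz : z.1 ∈ A <;> simp [Set.indicator, hz]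

/-- `K^* v` is the conditional expectation of `v(x)` given `y`. -/
lemma setIntegral_fst_eq (h : κ.Invariant μ) {v : X → ℝ} (hv : MemLp v 2 μ) {A : Set X}
    (hA : MeasurableSet A) :
    ∫ z in Prod.snd ⁻¹' A, v z.1 ∂(μ ⊗ₘ κ) =
      ∫ y in A, ContinuousLinearMap.adjoint (koopman h) (hv.toLp v) y ∂μ := by
  rw [← inner_toLp_indicator hA, ContinuousLinearMap.adjoint_inner_right, real_inner_comm,
    ← integral_fst_mul_snd h hv (memLp_indicator_one hA), ← integral_indicator (measurable_snd hA)]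
  refine integral_congr_ae (Filter.Eventually.of_forall fun z => ?_)
  by_cases hz : z.2 ∈ A <;> simp [Set.indicator, hz]

end KoopmanConditioning

/-! ### The functions `g` and `g*` -/

section VarianceFunctions

variable {X : Type*} {H : Type*} [NormedAddCommGroup H] [InnerProductSpace ℝ H]
  [CompleteSpace H] [RKHS ℝ H X ℝ] {ι : Type*} (b : HilbertBasis ι ℝ H)
  [TopologicalSpace X] [MeasurableSpace X] [SecondCountableTopology X] [BorelSpace X]
  {μ : Measure X} [IsProbabilityMeasure μ] {κ : Kernel X X} [IsMarkovKernel κ]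

lemma Compatible.stronglyMeasurable_coe (hc : Compatible H μ) (ψ : H) :
    StronglyMeasurable (ψ : X → ℝ) := by
  have h1 : (ψ : X → ℝ) = fun x => inner ℝ (feature H x) ψ :=
    funext fun x => (inner_feature H x ψ).symm
  rw [h1]
  exact (hc.continuous_feature.inner continuous_const).stronglyMeasurable

lemma memLp_pairVec_apply (hc : Compatible H μ) (h : κ.Invariant μ) (p : ι × ι) :
    MemLp (fun z : X × X => pairVec b z p) 2 (μ ⊗ₘ κ) :=
  (lp.evalCLM ℝ (fun _ : ι × ι => ℝ) 2 p).comp_memLp' (memLp_pairVec b hc h)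

/-- As a product of two $L^2$ functions $g_{ij}$ is a priori only in $L^1$. But it is the
conditional expectation given `x` of the entry $f_j(x)f_i(y)$, which is square integrable because
`pairVec` is. -/
lemma eLpNorm_gFun_le (hc : Compatible H μ) (h : κ.Invariant μ) (i j : ι) :
    eLpNorm (gFun hc h b i j) 2 μ ≤ eLpNorm (fun z => pairVec b z (i, j)) 2 (μ ⊗ₘ κ) := by
  have hF := (memLp_pairVec_apply b hc h (i, j)).integrable one_le_two
  simp only [pairVec_apply] at hF ⊢
  exact eLpNorm_mul_le_of_setIntegral_eq (measurePreserving_fst κ μ)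
    (((hc.memLp_coe (b i)).comp_measurePreserving (measurePreserving_snd h)).integrable one_le_two)
    ((Lp.memLp _).integrable one_le_two) (Lp.stronglyMeasurable _)
    (fun A hA => setIntegral_snd_eq h (hc.memLp_coe (b i)) hA) (hc.stronglyMeasurable_coe (b j)) hF

lemma eLpNorm_gStarFun_le (hc : Compatible H μ) (h : κ.Invariant μ) (i j : ι) :
    eLpNorm (gStarFun hc h b j i) 2 μ ≤ eLpNorm (fun z => pairVec b z (i, j)) 2 (μ ⊗ₘ κ) := by
  have hF := (memLp_pairVec_apply b hc h (i, j)).integrable one_le_two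
  -- Conditioning is now on `y`, so the factor to be pulled out, $f_i(y)$, has to stand first.
  simp only [pairVec_apply, mul_comm (b j _)] at hF ⊢
  exact eLpNorm_mul_le_of_setIntegral_eq (measurePreserving_snd h)
    (((hc.memLp_coe (b j)).comp_measurePreserving (measurePreserving_fst κ μ)).integrable
      one_le_two)
    ((Lp.memLp _).integrable one_le_two) (Lp.stronglyMeasurable _)
    (fun A hA => setIntegral_fst_eq h (hc.memLp_coe (b j)) hA) (hc.stronglyMeasurable_coe (b i)) hF

lemma memLp_gFun (hc : Compatible H μ) (h : κ.Invariant μ) (i j : ι) :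
    MemLp (gFun hc h b i j) 2 μ :=
  ⟨((hc.stronglyMeasurable_coe _).mul (Lp.stronglyMeasurable _)).aestronglyMeasurable,
    (eLpNorm_gFun_le b hc h i j).trans_lt (memLp_pairVec_apply b hc h (i, j)).2⟩

lemma memLp_gStarFun (hc : Compatible H μ) (h : κ.Invariant μ) (i j : ι) :
    MemLp (gStarFun hc h b j i) 2 μ :=
  ⟨((hc.stronglyMeasurable_coe _).mul (Lp.stronglyMeasurable _)).aestronglyMeasurable,
    (eLpNorm_gStarFun_le b hc h i j).trans_lt (memLp_pairVec_apply b hc h (i, j)).2⟩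

lemma toL2_eq {g : X → ℝ} (hg : MemLp g 2 μ) : toL2 μ g = hg.toLp g := dif_pos hg

/-- The moment `E[f_j(x) f_i(y) η(y)]` in terms of `g*`. -/
lemma integral_pairVec_mul_snd (hc : Compatible H μ) (h : κ.Invariant μ) (i j : ι)
    (η : Lp ℝ 2 μ) : ∫ z, pairVec b z (i, j) * η z.2 ∂(μ ⊗ₘ κ) =
      inner ℝ (toL2 μ (gStarFun hc h b j i)) η := by
  have hF : Integrable (fun z => pairVec b z (i, j) * η z.2) (μ ⊗ₘ κ) :=
    (memLp_pairVec_apply b hc h (i, j)).integrable_mul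
      ((Lp.memLp η).comp_measurePreserving (measurePreserving_snd h))
  have e : ∀ z : X × X, pairVec b z (i, j) * η z.2 = (b i z.2 * η z.2) * b j z.1 := fun z => by
    rw [pairVec_apply]; ring
  simp only [e] at hF ⊢
  rw [integral_mul_eq_of_setIntegral_eq (f := fun z => b j z.1) (g := fun y => b i y * η y)
    (measurePreserving_snd h)
    (((hc.memLp_coe (b j)).comp_measurePreserving (measurePreserving_fst κ μ)).integrable
      one_le_two)
    ((Lp.memLp _).integrable one_le_two) (Lp.stronglyMeasurable _)
    (fun A hA => setIntegral_fst_eq h (hc.memLp_coe (b j)) hA)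
    ((hc.stronglyMeasurable_coe (b i)).mul (Lp.stronglyMeasurable η)) hF, toL2_eq
    (memLp_gStarFun b hc h i j), L2.inner_def]
  refine integral_congr_ae ?_
  filter_upwards [(memLp_gStarFun b hc h i j).coeFn_toLp] with y hy
  rw [hy, gStarFun]
  change b i y * η y * ContinuousLinearMap.adjoint (koopman h) (incl hc (b j)) y = _
  simp
  ring

lemma inner_gStarFun_oneL2 (hc : Compatible H μ) (h : κ.Invariant μ) (i j : ι) :
    inner ℝ (toL2 μ (gStarFun hc h b j i)) (oneL2 μ) = ∫ z, pairVec b z (i, j) ∂(μ ⊗ₘ κ) := by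
  rw [← integral_pairVec_mul_snd]
  refine integral_congr_ae ?_
  filter_upwards [(measurePreserving_snd h).quasiMeasurePreserving.ae_eq_comp
    (oneL2_coeFn (μ := μ))] with z hz
  have : oneL2 μ z.2 = 1 := hz
  rw [this, mul_one]

lemma inner_oneL2_gFun (hc : Compatible H μ) (h : κ.Invariant μ) (i j : ι) :
    inner ℝ (oneL2 μ) (toL2 μ (gFun hc h b i j)) = ∫ z, pairVec b z (i, j) ∂(μ ⊗ₘ κ) := by
  have hF := (memLp_pairVec_apply b hc h (i, j)).integrable one_le_two
  simp only [pairVec_apply] at hF ⊢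
  rw [inner_oneL2, toL2_eq (memLp_gFun b hc h i j),
    integral_congr_ae (memLp_gFun b hc h i j).coeFn_toLp]
  exact (integral_mul_eq_of_setIntegral_eq (measurePreserving_fst κ μ)
    (((hc.memLp_coe (b i)).comp_measurePreserving (measurePreserving_snd h)).integrable one_le_two)
    ((Lp.memLp _).integrable one_le_two) (Lp.stronglyMeasurable _)
    (fun A hA => setIntegral_snd_eq h (hc.memLp_coe (b i)) hA)
    (hc.stronglyMeasurable_coe (b j)) hF).symm

end VarianceFunctions

/-! ### Centering in `L²` -/

section Centering

variable {X : Type*} [MeasurableSpace X] {κ : Kernel X X} [IsMarkovKernel κ]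
  {μ : Measure X} [IsProbabilityMeasure μ]

lemma norm_oneL2 : ‖oneL2 μ‖ = 1 := by
  rw [← sq_eq_sq₀ (norm_nonneg _) zero_le_one, ← real_inner_self_eq_norm_sq, inner_oneL2,
    integral_congr_ae oneL2_coeFn]
  simp

lemma koopman_oneL2 (h : κ.Invariant μ) : koopman h (oneL2 μ) = oneL2 μ := by
  refine Lp.ext ?_
  filter_upwards [koopman_coeFn h (oneL2 μ), oneL2_coeFn (μ := μ),
    ae_ae_kernel h (oneL2_coeFn (μ := μ))] with x h1 h2 h3
  rw [h1, h2, integral_congr_ae h3]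
  simp

lemma coe_koopman0_pow (h : κ.Invariant μ) (n : ℕ) (ψ : L20 μ) :
    (((koopman0 h) ^ n) ψ : Lp ℝ 2 μ) = ((koopman h) ^ n) (ψ : Lp ℝ 2 μ) := by
  induction n with
  | zero => rfl
  | succ n ih =>
    rw [pow_succ', pow_succ']
    change koopman h (((koopman0 h) ^ n) ψ : Lp ℝ 2 μ) = koopman h (((koopman h) ^ n) ψ)
    rw [ih]

lemma coe_orthogonalProjectionOnto_L20 (ψ : Lp ℝ 2 μ) :
    ((L20 μ).orthogonalProjectionOnto ψ : Lp ℝ 2 μ) = ψ - inner ℝ (oneL2 μ) ψ • oneL2 μ := by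
  refine Submodule.eq_starProjection_of_mem_orthogonal (K := L20 μ)
    (Submodule.mem_orthogonal_singleton_iff_inner_right.2 ?_) ?_
  · rw [inner_sub_right, real_inner_smul_right, real_inner_self_eq_norm_sq, norm_oneL2]
    ring
  · rw [sub_sub_cancel]
    exact Submodule.smul_mem _ _
      (Submodule.le_orthogonal_orthogonal _ (Submodule.mem_span_singleton_self _))

/-- `K` fixes the constants, so both projections together remove a single product of means. The
projection on the left is free, as the right argument already lies in $\mathbb 1^\perp$. -/
lemma inner_koopman0_pow (h : κ.Invariant μ) (n : ℕ) (ψ η : Lp ℝ 2 μ) :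
    inner ℝ ((L20 μ).orthogonalProjectionOnto ψ)
      (((koopman0 h) ^ n) ((L20 μ).orthogonalProjectionOnto η)) =
      inner ℝ ψ (((koopman h) ^ n) η) - inner ℝ ψ (oneL2 μ) * inner ℝ (oneL2 μ) η := by
  have h1 : ((koopman h) ^ n) (oneL2 μ) = oneL2 μ := by
    induction n with
    | zero => rfl
    | succ n ih =>
      rw [pow_succ']
      change koopman h (((koopman h) ^ n) (oneL2 μ)) = _
      rw [ih, koopman_oneL2]
  rw [Submodule.inner_orthogonalProjectionOnto_eq_of_mem_right, coe_koopman0_pow,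
    coe_orthogonalProjectionOnto_L20, map_sub, map_smul, h1, inner_sub_right,
    real_inner_smul_right, mul_comm]

end Centering

/-! ### Mercer bases are orthonormal bases of the reproducing kernel Hilbert space -/

section Mercer

variable {X : Type*} {H : Type*} [NormedAddCommGroup H] [InnerProductSpace ℝ H]
  [CompleteSpace H] [RKHS ℝ H X ℝ]
  [TopologicalSpace X] [MeasurableSpace X] [SecondCountableTopology X] [BorelSpace X]
  {μ : Measure X} [IsProbabilityMeasure μ]

lemma incl_injective (hc : Compatible H μ) {ψ : H} (hψ : incl hc ψ = 0) : ψ = 0 := by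
  refine RKHS.ext (𝕜 := ℝ) (X := X) (V := ℝ) fun x => ?_
  rw [hc.eq_zero_of_ae ψ ?_ x]
  · simp
  have h1 : (incl hc ψ : X → ℝ) =ᵐ[μ] ψ := (hc.memLp_coe ψ).coeFn_toLp
  filter_upwards [h1, Lp.coeFn_zero ℝ 2 μ] with x h2 h3
  rw [← h2, hψ, h3]
  rfl

/-- The inclusion is injective by (A3), so the two sides may be compared in $L^2_\mu$, where both
equal $\lambda_je_j$. -/
lemma IsMercerBasis.embed_eq {hc : Compatible H μ} {ι : Type*} {e : HilbertBasis ι ℝ (Lp ℝ 2 μ)}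
    {lam : ι → ℝ} {f : ι → H} (hB : IsMercerBasis hc e lam f) (j : ι) :
    embed hc (e j) = √(lam j) • f j := by
  rw [← sub_eq_zero]
  refine incl_injective hc ?_
  have h1 := hB.eigen j
  rw [adjoint_embed] at h1
  rw [map_sub, h1, map_smul, hB.incl_eq, smul_smul, Real.mul_self_sqrt (hB.pos j).le, sub_self]

/-- Since `embed` and `incl` are adjoint, $\sqrt{\lambda_i}\langle
f_i,f_j\rangle=\sqrt{\lambda_j}\langle e_i,e_j\rangle_\mu$, which gives orthonormality. A vector
orthogonal to every $f_j$ has an inclusion orthogonal to every $e_j$, hence is zero. -/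
lemma IsMercerBasis.exists_hilbertBasis {hc : Compatible H μ} {ι : Type*}
    {e : HilbertBasis ι ℝ (Lp ℝ 2 μ)} {lam : ι → ℝ} {f : ι → H}
    (hB : IsMercerBasis hc e lam f) : ∃ b : HilbertBasis ι ℝ H, ⇑b = f := by
  classical
  have hpos : ∀ j, 0 < √(lam j) := fun j => Real.sqrt_pos.2 (hB.pos j)
  have hon : Orthonormal ℝ f := by
    rw [orthonormal_iff_ite]
    intro i j
    have h1 : √(lam i) * inner ℝ (f i) (f j) = √(lam j) * inner ℝ (e i) (e j) := by
      rw [← real_inner_smul_left, ← hB.embed_eq, inner_embed, hB.incl_eq, real_inner_smul_right]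
    rw [orthonormal_iff_ite.1 e.orthonormal i j] at h1
    split_ifs with hij
    · subst hij
      rw [if_pos rfl] at h1
      exact mul_left_cancel₀ (hpos i).ne' h1
    · rw [if_neg hij, mul_zero] at h1
      exact (mul_eq_zero.1 h1).resolve_left (hpos i).ne'
  have hbot : (Submodule.span ℝ (Set.range f))ᗮ = ⊥ := by
    rw [eq_bot_iff]
    intro ψ hψ
    refine (Submodule.mem_bot ℝ).2 (incl_injective hc ?_)
    have h1 : ∀ j, inner ℝ (e j) (incl hc ψ) = 0 := fun j => by
      rw [← inner_embed, hB.embed_eq, real_inner_smul_left,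
        (Submodule.mem_orthogonal _ _).1 hψ _ (Submodule.subset_span ⟨j, rfl⟩), mul_zero]
    have h2 := hasSum_inner_sq e (incl hc ψ)
    simp only [h1, zero_pow two_ne_zero] at h2
    have h3 := h2.unique hasSum_zero
    exact norm_eq_zero.1 (pow_eq_zero_iff two_ne_zero |>.1 h3)
  exact ⟨HilbertBasis.mkOfOrthogonalEqBot hon hbot, HilbertBasis.coe_mkOfOrthogonalEqBot hon hbot⟩

/-- The features span a dense subspace, and they form the continuous image of a second countable
space. Orthonormal bases of `H` are thus countable, as needed to exchange the sum over entries with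
the expectation. -/
lemma Compatible.separableSpace (hc : Compatible H μ) : TopologicalSpace.SeparableSpace H := by
  have h1 : TopologicalSpace.IsSeparable (Set.range (feature H : X → H)) :=
    TopologicalSpace.isSeparable_range hc.continuous_feature
  have h2 : TopologicalSpace.IsSeparable
      (closure (Submodule.span ℝ (Set.range (feature H : X → H)) : Set H)) :=
    (h1.span (R := ℝ)).closure
  rw [← TopologicalSpace.isSeparable_univ_iff]
  convert h2
  have h3 := RKHS.kerFun_dense (𝕜 := ℝ) (H := H) (X := X) (V := ℝ)
  rw [eq_comm, Set.eq_univ_iff_forall]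
  intro ψ
  have h4 : ψ ∈ (Submodule.span ℝ
      {RKHS.kerFun H x v | (x : X) (v : ℝ)}).topologicalClosure := by
    rw [h3]; trivial
  refine closure_mono (SetLike.coe_subset_coe.2 (Submodule.span_le.2 ?_)) h4
  rintro _ ⟨x, v, rfl⟩
  have h5 : RKHS.kerFun H x v = v • feature H x := by
    rw [feature, ← map_smul, smul_eq_mul, mul_one]
  rw [h5]
  exact Submodule.smul_mem _ _ (Submodule.subset_span ⟨x, rfl⟩)

lemma countable_of_orthonormal {E ι : Type*} [NormedAddCommGroup E] [InnerProductSpace ℝ E]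
    [TopologicalSpace.SeparableSpace E] {v : ι → E} (hv : Orthonormal ℝ v) : Countable ι := by
  refine Pairwise.countable_of_isOpen_disjoint (s := fun i => Metric.ball (v i) (1 / 2)) ?_
    (fun i => Metric.isOpen_ball) (fun i => ⟨v i, by simp⟩)
  intro i j hij
  refine Metric.ball_disjoint_ball ?_
  -- Distance $\sqrt2>1$ keeps the balls of radius `1 / 2` disjoint.
  have h1 : ‖v i - v j‖ ^ 2 = 2 := by
    rw [norm_sub_sq_real, hv.1, hv.1, hv.2 hij]
    norm_num
  rw [dist_eq_norm]
  nlinarith [norm_nonneg (v i - v j)]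

end Mercer

/-! ### The Markov property -/

section Markov

variable {X : Type*} [MeasurableSpace X] {ρ : TransitionSemigroup X} {μ : Measure X}
  [IsProbabilityMeasure μ] {Ω : Type*} [MeasurableSpace Ω] {P : Measure Ω}
  [IsProbabilityMeasure P] {Z : ℝ≥0 → Ω → X}

lemma IsMarkovProcess.past_le (hZ : IsMarkovProcess ρ μ P Z) (s : ℝ≥0) :
    past Z s ≤ ‹MeasurableSpace Ω› := iSup_le fun r => (hZ.measurable r).comap_le

lemma measurable_past (Z : ℝ≥0 → Ω → X) {r s : ℝ≥0} (hrs : r ≤ s) : Measurable[past Z s] (Z r) :=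
  measurable_iff_comap_le.2 (le_iSup (fun r : Set.Iic s => MeasurableSpace.comap (Z r) _) ⟨r, hrs⟩)

/-- The Markov property as an identity of measures: on an event of the past, the law at time `s` is
transported by the kernel. In this form it passes from indicators to integrable functions without
approximation. -/
lemma IsMarkovProcess.map_restrict (hZ : IsMarkovProcess ρ μ P Z) (s t : ℝ≥0) {S : Set Ω}
    (hS : MeasurableSet[past Z s] S) :
    (P.restrict S).map (Z (s + t)) = ρ.ker t ∘ₘ (P.restrict S).map (Z s) := by
  have hS' := hZ.past_le s S hS
  have hZs := hZ.measurable s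
  ext A hA
  have hm : Measurable fun ω => ρ.ker t (Z s ω) A := (Kernel.measurable_coe _ hA).comp hZs
  rw [Measure.map_apply (hZ.measurable _) hA, Measure.bind_apply hA (Kernel.aemeasurable _),
    lintegral_map (Kernel.measurable_coe _ hA) hZs]
  have hpre : MeasurableSet (Z (s + t) ⁻¹' A) := hZ.measurable _ hA
  have h1 := setIntegral_condExp (μ := P) (hZ.past_le s)
    (f := (Z (s + t) ⁻¹' A).indicator fun _ => (1 : ℝ))
    ((integrable_const 1).indicator hpre) hS
  rw [setIntegral_congr_ae (g := fun ω => (ρ.ker t (Z s ω)).real A) hS'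
    ((hZ.markov s t A hA).mono fun ω h _ => h), integral_indicator hpre] at h1
  simp only [integral_const, smul_eq_mul, mul_one, measureReal_restrict_apply_univ] at h1
  have h2 : ∫ ω in S, (ρ.ker t (Z s ω)).real A ∂P =
      (∫⁻ ω in S, ρ.ker t (Z s ω) A ∂P).toReal :=
    integral_toReal hm.aemeasurable (Filter.Eventually.of_forall fun ω => measure_lt_top _ _)
  have hfin : ∫⁻ ω in S, ρ.ker t (Z s ω) A ∂P ≠ ∞ := by
    refine ((lintegral_mono fun ω => prob_le_one).trans_lt ?_).ne
    simp
  rw [h2] at h1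
  rw [← ENNReal.toReal_eq_toReal_iff' (measure_ne_top _ _) hfin, h1]
  rfl

lemma IsMarkovProcess.map_eq (hZ : IsMarkovProcess ρ μ P Z) (hμ : ρ.IsInvariant μ) (s : ℝ≥0) :
    P.map (Z s) = μ := by
  have h1 := hZ.map_restrict 0 s MeasurableSet.univ
  rwa [Measure.restrict_univ, zero_add, hZ.map_zero, (hμ s).def] at h1

lemma IsMarkovProcess.measurePreserving (hZ : IsMarkovProcess ρ μ P Z) (hμ : ρ.IsInvariant μ)
    (s : ℝ≥0) : MeasurePreserving (Z s) P μ :=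
  ⟨hZ.measurable s, hZ.map_eq hμ s⟩

lemma IsMarkovProcess.measurePreserving_pair (hZ : IsMarkovProcess ρ μ P Z)
    (hμ : ρ.IsInvariant μ) (s t : ℝ≥0) :
    MeasurePreserving (fun ω => (Z s ω, Z (s + t) ω)) P (μ ⊗ₘ ρ.ker t) := by
  have hm : Measurable fun ω => (Z s ω, Z (s + t) ω) :=
    (hZ.measurable s).prodMk (hZ.measurable _)
  refine ⟨hm, Measure.ext_prod fun {A B} hA hB => ?_⟩
  have h1 := congrArg (fun ν => ν B)
    (hZ.map_restrict s t (S := Z s ⁻¹' A) (measurable_past Z le_rfl hA))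
  rw [Measure.map_apply (hZ.measurable _) hB,
    Measure.restrict_apply (hZ.measurable _ hB), ← Measure.restrict_map (hZ.measurable s) hA,
    hZ.map_eq hμ, Measure.bind_apply hB (Kernel.aemeasurable _)] at h1
  rw [Measure.map_apply hm (hA.prod hB), Measure.compProd_apply_prod hA hB, ← h1, Set.inter_comm]
  rfl

lemma IsMarkovProcess.koopman_ae_eq_condExp (hZ : IsMarkovProcess ρ μ P Z)
    (hμ : ρ.IsInvariant μ) (s t : ℝ≥0) (ψ : Lp ℝ 2 μ) :
    (fun ω => koopman (hμ t) ψ (Z s ω)) =ᵐ[P] P[fun ω => ψ (Z (s + t) ω) | past Z s] := by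
  have hi : ∀ (r : ℝ≥0) (η : Lp ℝ 2 μ), Integrable (fun ω => η (Z r ω)) P := fun r η =>
    (hZ.measurePreserving hμ r).integrable_comp_of_integrable
      ((Lp.memLp η).integrable one_le_two)
  refine ae_eq_condExp_of_forall_setIntegral_eq (hZ.past_le s) (hi _ ψ)
    (fun S _ _ => (hi s _).integrableOn) (fun S hS _ => ?_)
    ((Lp.stronglyMeasurable _).comp_measurable (measurable_past Z le_rfl)).aestronglyMeasurable
  have hS' := hZ.past_le s S hS
  -- `K ψ` is known only `μ`-a.e.; absolute continuity carries its formula over to the restricted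
  -- law.
  have hac : (P.restrict S).map (Z s) ≪ μ := by
    rw [← hZ.map_eq hμ s]
    exact Measure.absolutelyContinuous_of_le
      (Measure.map_mono Measure.restrict_le_self (hZ.measurable s))
  have hsm := Lp.stronglyMeasurable ψ
  have hint : Integrable ψ ((P.restrict S).map (Z (s + t))) :=
    (integrable_map_measure hsm.aestronglyMeasurable (hZ.measurable _).aemeasurable).2
      (hi _ ψ).integrableOn
  have h1 : ∫ ω in S, koopman (hμ t) ψ (Z s ω) ∂P =
      ∫ z, koopman (hμ t) ψ z ∂(P.restrict S).map (Z s) :=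
    (integral_map (hZ.measurable s).aemeasurable
      (Lp.stronglyMeasurable _).aestronglyMeasurable).symm
  have h2 : ∫ ω in S, ψ (Z (s + t) ω) ∂P = ∫ z, ψ z ∂(P.restrict S).map (Z (s + t)) :=
    (integral_map (hZ.measurable _).aemeasurable hsm.aestronglyMeasurable).symm
  rw [h1, h2, integral_congr_ae (hac.ae_le (koopman_coeFn (hμ t) ψ))]
  rw [hZ.map_restrict s t hS, Measure.comp_eq_comp_const_apply] at hint ⊢
  rw [Kernel.integral_comp hint, Kernel.const_apply]

/-- The Markov property for the product of a functional of the past and a function of the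
future. -/
lemma IsMarkovProcess.integral_mul_eq (hZ : IsMarkovProcess ρ μ P Z)
    (hμ : ρ.IsInvariant μ) (s t : ℝ≥0) (ψ : Lp ℝ 2 μ) {W : Ω → ℝ}
    (hW : StronglyMeasurable[past Z s] W) (hi : Integrable (fun ω => W ω * ψ (Z (s + t) ω)) P) :
    ∫ ω, W ω * ψ (Z (s + t) ω) ∂P = ∫ ω, W ω * koopman (hμ t) ψ (Z s ω) ∂P := by
  have h1 := condExp_mul_of_stronglyMeasurable_left (m := past Z s) (μ := P)
    (g := fun ω => ψ (Z (s + t) ω)) hW hi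
    ((hZ.measurePreserving hμ _).integrable_comp_of_integrable
      ((Lp.memLp ψ).integrable one_le_two))
  rw [← integral_condExp (hZ.past_le s)]
  refine integral_congr_ae ?_
  filter_upwards [h1, hZ.koopman_ae_eq_condExp hμ s t ψ] with ω h2 h3
  rw [h3]
  exact h2

/-- The last step is peeled off each time: `W`, known at time `s`, is also known at every later
time. -/
lemma IsMarkovProcess.integral_mul_eq_pow (hZ : IsMarkovProcess ρ μ P Z)
    (hμ : ρ.IsInvariant μ) (s t : ℝ≥0) (n : ℕ) (ψ : Lp ℝ 2 μ) {W : Ω → ℝ}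
    (hW : StronglyMeasurable[past Z s] W) (hW2 : MemLp W 2 P) :
    ∫ ω, W ω * ψ (Z (s + n * t) ω) ∂P =
      ∫ ω, W ω * ((koopman (hμ t)) ^ n) ψ (Z s ω) ∂P := by
  induction n generalizing ψ with
  | zero => simp
  | succ n ih =>
    have e : s + ((n + 1 : ℕ) : ℝ≥0) * t = s + n * t + t := by push_cast; ring
    have hle : past Z s ≤ past Z (s + n * t) :=
      iSup_le fun r => (measurable_past Z (le_add_right (Set.mem_Iic.1 r.2))).comap_le
    rw [e, hZ.integral_mul_eq hμ _ t ψ (hW.mono hle)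
      (hW2.integrable_mul ((Lp.memLp ψ).comp_measurePreserving (hZ.measurePreserving hμ _))),
      ih, pow_succ]
    rfl

end Markov

/-! ### Exchanging expectation and the sum over matrix entries -/

section LpValued

variable {α : Type*} [MeasurableSpace α] {ν : Measure α} {β : Type*}

lemma memLp_lp_apply {v : α → lp (fun _ : β => ℝ) 2} (hv : MemLp v 2 ν) (p : β) :
    MemLp (fun a => v a p) 2 ν :=
  (lp.evalCLM ℝ (fun _ : β => ℝ) 2 p).comp_memLp' hv

lemma summable_integral_sq {v : α → lp (fun _ : β => ℝ) 2} (hv : MemLp v 2 ν) :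
    Summable fun p => ∫ a, v a p ^ 2 ∂ν := by
  have hi : ∀ p, Integrable (fun a => v a p ^ 2) ν := fun p => (memLp_lp_apply hv p).integrable_sq
  refine summable_of_sum_le (c := ∫ a, ‖v a‖ ^ 2 ∂ν)
    (fun p => integral_nonneg fun a => sq_nonneg _) fun S => ?_
  rw [← integral_finsetSum _ fun p _ => hi p]
  refine integral_mono (integrable_finsetSum _ fun p _ => hi p)
    ((memLp_two_iff_integrable_sq_norm hv.1).1 hv) fun a => ?_
  exact sum_le_hasSum S (fun p _ => sq_nonneg _) (hasSum_sq_lp (v a))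

/-- The products are dominated by $v_p^2+w_p^2$, whose integrals are summable by Bessel's inequality
under the integral. -/
lemma hasSum_integral_mul [Countable β] {v w : α → lp (fun _ : β => ℝ) 2} (hv : MemLp v 2 ν)
    (hw : MemLp w 2 ν) :
    HasSum (fun p => ∫ a, v a p * w a p ∂ν) (∫ a, inner ℝ (v a) (w a) ∂ν) := by
  have hi : ∀ p, Integrable (fun a => v a p * w a p) ν := fun p =>
    (memLp_lp_apply hv p).integrable_mul (memLp_lp_apply hw p)
  have hs : Summable fun p => ∫ a, ‖v a p * w a p‖ ∂ν := by
    refine Summable.of_nonneg_of_le (fun p => integral_nonneg fun a => norm_nonneg _) (fun p => ?_)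
      ((summable_integral_sq hv).add (summable_integral_sq hw))
    have h1 := (memLp_lp_apply hv p).integrable_sq
    have h2 := (memLp_lp_apply hw p).integrable_sq
    rw [← integral_add h1 h2]
    refine integral_mono (hi p).norm (h1.add h2) fun a => ?_
    rw [Real.norm_eq_abs]
    exact abs_le.2 ⟨by nlinarith [sq_nonneg (v a p + w a p)],
      by nlinarith [sq_nonneg (v a p - w a p)]⟩
  have h := hasSum_integral_of_summable_integral_norm hi hs
  have e : ∀ a, ∑' p, v a p * w a p = inner ℝ (v a) (w a) := fun a => by
    rw [← (lp.hasSum_inner (𝕜 := ℝ) (v a) (w a)).tsum_eq]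
    exact tsum_congr fun p => by simp [mul_comm]
  simpa only [e] using h

end LpValued

/-! ### Double sums of stationary covariances -/

section DoubleSum

/-- Lag `n + 1` occurs `m - (n + 1)` times on each side of the diagonal. The term `n = m - 1` has
weight zero, which permits summing over all of `range m`. -/
lemma sum_range_sum_range_eq (s : ℕ → ℕ → ℝ) (e : ℝ) (τ : ℕ → ℝ) (hdiag : ∀ k, s k k = e)
    (hsymm : ∀ k l, s k l = s l k) (hs : ∀ k n, s k (k + 1 + n) = τ n) (m : ℕ) :
    ∑ k ∈ Finset.range m, ∑ l ∈ Finset.range m, s k l =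
      m * e + 2 * ∑ n ∈ Finset.range m, ((m : ℝ) - (n + 1)) * τ n := by
  induction m with
  | zero => simp
  | succ m ih =>
    -- The new column lists the lags in reverse order: `s k m = τ (m - 1 - k)`.
    have h1 : ∑ k ∈ Finset.range m, s k m = ∑ n ∈ Finset.range m, τ n := by
      rw [← Finset.sum_range_reflect τ]
      refine Finset.sum_congr rfl fun k hk => ?_
      rw [← hs k]
      congr 1
      have := Finset.mem_range.1 hk
      omega
    have h2 : ∑ l ∈ Finset.range m, s m l = ∑ n ∈ Finset.range m, τ n := by
      rw [← h1]
      exact Finset.sum_congr rfl fun l _ => hsymm _ _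
    have h3 : ∑ n ∈ Finset.range (m + 1), (((m + 1 : ℕ) : ℝ) - (n + 1)) * τ n =
        ∑ n ∈ Finset.range m, ((m : ℝ) - (n + 1)) * τ n + ∑ n ∈ Finset.range m, τ n := by
      rw [Finset.sum_range_succ, ← Finset.sum_add_distrib]
      push_cast
      rw [sub_self, zero_mul, add_zero]
      exact Finset.sum_congr rfl fun n _ => by ring
    rw [h3, Finset.sum_range_succ]
    simp only [Finset.sum_range_succ (fun l => s _ l) m]
    rw [Finset.sum_add_distrib, ih, h1, h2, hdiag]
    push_cast
    ring

end DoubleSum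

/-! ### The variance of the sliding window estimator -/

section SlidingWindow

variable {X : Type*} {H : Type*} [NormedAddCommGroup H] [InnerProductSpace ℝ H]
  [CompleteSpace H] [RKHS ℝ H X ℝ] {ι : Type*} (b : HilbertBasis ι ℝ H)
  [TopologicalSpace X] [MeasurableSpace X] [SecondCountableTopology X] [BorelSpace X]
  {μ : Measure X} [IsProbabilityMeasure μ] {κ : Kernel X X} [IsMarkovKernel κ]

/-- The autocovariance `⟨Q g*_{ji}, K₀ ^ n Q g_{ij}⟩` at lag `n + 1`. -/
def lagTerm (hc : Compatible H μ) (h : κ.Invariant μ) (f : ι → H) (n : ℕ) (p : ι × ι) : ℝ :=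
  inner ℝ ((L20 μ).orthogonalProjectionOnto (toL2 μ (gStarFun hc h f p.2 p.1)))
    (((koopman0 h) ^ n) ((L20 μ).orthogonalProjectionOnto (toL2 μ (gFun hc h f p.1 p.2))))

lemma varTerm_eq_sum_lagTerm (hc : Compatible H μ) (h : κ.Invariant μ) (f : ι → H) (m : ℕ)
    (p : ι × ι) : varTerm hc h f m p =
      ∑ k ∈ Finset.Icc 1 (m - 1), 2 * (((m : ℝ) - k) / m) * lagTerm hc h f (k - 1) p := by
  simp only [varTerm, Fpoly, sum_apply, smul_apply, inner_sum, real_inner_smul_right, lagTerm]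

lemma norm_toL2_le_of_eLpNorm_le {g : X → ℝ} {F : X × X → ℝ} (hg : MemLp g 2 μ)
    (hF : MemLp F 2 (μ ⊗ₘ κ)) (hgF : eLpNorm g 2 μ ≤ eLpNorm F 2 (μ ⊗ₘ κ)) :
    ‖toL2 μ g‖ ≤ ‖hF.toLp F‖ := by
  rw [toL2_eq hg, Lp.norm_toLp, Lp.norm_toLp]
  exact ENNReal.toReal_mono hF.2.ne hgF

/-- Projections contract, and $g_{ij}$, $g^*_{ji}$ are both bounded in $L^2$ by the same matrix
entry. The resulting majorant is summable in `p`, since `pairVec` has finite second moment. -/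
lemma abs_lagTerm_le (hc : Compatible H μ) (h : κ.Invariant μ) (n : ℕ) (p : ι × ι) :
    |lagTerm hc h b n p| ≤ ‖(koopman0 h) ^ n‖ * ∫ z, pairVec b z p ^ 2 ∂(μ ⊗ₘ κ) := by
  have hF := memLp_pairVec_apply b hc h p
  have hF2 : ∫ z, pairVec b z p ^ 2 ∂(μ ⊗ₘ κ) = ‖hF.toLp _‖ * ‖hF.toLp _‖ := by
    rw [← sq, ← real_inner_self_eq_norm_sq, L2.inner_def]
    refine integral_congr_ae ?_
    filter_upwards [hF.coeFn_toLp] with z hz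
    rw [hz, real_inner_self_eq_norm_sq, Real.norm_eq_abs, sq_abs]
  have h1 : ‖toL2 μ (gFun hc h b p.1 p.2)‖ ≤ ‖hF.toLp _‖ :=
    norm_toL2_le_of_eLpNorm_le (memLp_gFun b hc h _ _) hF (eLpNorm_gFun_le b hc h _ _)
  have h2 : ‖toL2 μ (gStarFun hc h b p.2 p.1)‖ ≤ ‖hF.toLp _‖ :=
    norm_toL2_le_of_eLpNorm_le (memLp_gStarFun b hc h _ _) hF (eLpNorm_gStarFun_le b hc h _ _)
  have hQ : ∀ ψ : Lp ℝ 2 μ, ‖(L20 μ).orthogonalProjectionOnto ψ‖ ≤ ‖ψ‖ := fun ψ =>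
    (L20 μ).norm_orthogonalProjectionOnto_apply_le ψ
  rw [hF2, lagTerm]
  calc _ ≤ ‖(L20 μ).orthogonalProjectionOnto (toL2 μ (gStarFun hc h b p.2 p.1))‖ *
        ‖((koopman0 h) ^ n) ((L20 μ).orthogonalProjectionOnto (toL2 μ (gFun hc h b p.1 p.2)))‖ :=
        abs_real_inner_le_norm _ _
    _ ≤ ‖hF.toLp _‖ * (‖(koopman0 h) ^ n‖ * ‖hF.toLp _‖) :=
        mul_le_mul ((hQ _).trans h2)
          ((((koopman0 h) ^ n).le_opNorm _).trans
            (mul_le_mul_of_nonneg_left ((hQ _).trans h1)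
              (ContinuousLinearMap.opNorm_nonneg _)))
          (norm_nonneg _) (norm_nonneg _)
    _ = _ := by ring

lemma summable_lagTerm (hc : Compatible H μ) (h : κ.Invariant μ) (n : ℕ) :
    Summable (lagTerm hc h b n) :=
  Summable.of_norm_bounded ((summable_integral_sq (memLp_pairVec b hc h)).mul_left _)
    (abs_lagTerm_le b hc h n)

lemma summable_varTerm (hc : Compatible H μ) (h : κ.Invariant μ) (m : ℕ) :
    Summable (varTerm hc h b m) := by
  simp only [funext (varTerm_eq_sum_lagTerm hc h b m)]
  exact summable_sum fun k _ => (summable_lagTerm b hc h _).mul_left _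

lemma tsum_varTerm (hc : Compatible H μ) (h : κ.Invariant μ) (m : ℕ) :
    ∑' p, varTerm hc h b m p = 2 / m *
      ∑ n ∈ Finset.range m, ((m : ℝ) - (n + 1)) * ∑' p, lagTerm hc h b n p := by
  simp only [varTerm_eq_sum_lagTerm]
  rw [Summable.tsum_finsetSum fun k _ => (summable_lagTerm b hc h _).mul_left _]
  simp only [tsum_mul_left]
  rcases m with _ | m
  · simp
  rw [Finset.sum_range_succ, Nat.add_sub_cancel, ← Finset.Ico_add_one_right_eq_Icc,
    Finset.sum_Ico_eq_sum_range]
  simp only [Nat.add_sub_cancel, Nat.add_sub_cancel_left]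
  push_cast
  -- The extra top index of `range` carries weight zero; the others match `k = n + 1`.
  rw [sub_self, zero_mul, add_zero, Finset.mul_sum]
  exact Finset.sum_congr rfl fun n _ => by ring

variable {ρ : TransitionSemigroup X} {Ω : Type*} [MeasurableSpace Ω] {P : Measure Ω}
  [IsProbabilityMeasure P] {Z : ℝ≥0 → Ω → X}

/-- The Markov property at time `u` turns the second entry into $g_{ij}(Z_u)$, and `n` further steps
bring it back to time `s + t` as $K^ng_{ij}$. What remains depends on the single pair
$(Z_s,Z_{s+t})$, and conditioning on its second component gives $g^*_{ji}$. For `n = 0` the two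
pairs share the state $Z_{s+t}$. -/
lemma IsMarkovProcess.integral_pairVec_mul_pairVec (hZ : IsMarkovProcess ρ μ P Z)
    (hμ : ρ.IsInvariant μ) (hc : Compatible H μ) (s t : ℝ≥0) (n : ℕ) (i j : ι) :
    ∫ ω, pairVec b (Z s ω, Z (s + t) ω) (i, j) *
        pairVec b (Z (s + t + n * t) ω, Z (s + t + n * t + t) ω) (i, j) ∂P =
      inner ℝ (toL2 μ (gStarFun hc (hμ t) b j i))
        (((koopman (hμ t)) ^ n) (toL2 μ (gFun hc (hμ t) b i j))) := by
  set u := s + t + n * t with hu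
  have hst : s + t ≤ u := by rw [hu]; exact le_self_add
  have hs : s ≤ s + t := le_self_add
  set A : Ω → ℝ := fun ω => pairVec b (Z s ω, Z (s + t) ω) (i, j) with hA
  have hAm : ∀ r, s + t ≤ r → StronglyMeasurable[past Z r] A := fun r hr => by
    simp only [hA, pairVec_apply]
    exact ((hc.stronglyMeasurable_coe (b j)).comp_measurable
      (measurable_past Z (hs.trans hr))).mul
      ((hc.stronglyMeasurable_coe (b i)).comp_measurable (measurable_past Z hr))
  have hA2 : MemLp A 2 P := (memLp_pairVec_apply b hc (hμ t) (i, j)).comp_measurePreserving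
    (hZ.measurePreserving_pair hμ s t)
  have hB2 : MemLp (fun ω => pairVec b (Z u ω, Z (u + t) ω) (i, j)) 2 P :=
    (memLp_pairVec_apply b hc (hμ t) (i, j)).comp_measurePreserving
      (hZ.measurePreserving_pair hμ u t)
  have hinc : (incl hc (b i) : X → ℝ) =ᵐ[μ] b i := (hc.memLp_coe (b i)).coeFn_toLp
  have hae : (fun ω => A ω * pairVec b (Z u ω, Z (u + t) ω) (i, j)) =ᵐ[P]
      fun ω => A ω * b j (Z u ω) * incl hc (b i) (Z (u + t) ω) := by
    filter_upwards [(hZ.measurePreserving hμ (u + t)).quasiMeasurePreserving.ae_eq_comp hinc]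
      with ω hω
    have : incl hc (b i) (Z (u + t) ω) = b i (Z (u + t) ω) := hω
    rw [this, pairVec_apply, mul_assoc]
  have hae2 : (fun ω => A ω * b j (Z u ω) * koopman (hμ t) (incl hc (b i)) (Z u ω)) =ᵐ[P]
      fun ω => A ω * toL2 μ (gFun hc (hμ t) b i j) (Z u ω) := by
    have hg := memLp_gFun b hc (hμ t) i j
    rw [toL2_eq hg]
    filter_upwards [(hZ.measurePreserving hμ u).quasiMeasurePreserving.ae_eq_comp hg.coeFn_toLp]
      with ω hω
    have : hg.toLp _ (Z u ω) = gFun hc (hμ t) b i j (Z u ω) := hω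
    rw [this, gFun, mul_assoc]
  rw [integral_congr_ae hae,
    hZ.integral_mul_eq hμ u t _ (W := fun ω => A ω * b j (Z u ω)) ((hAm u hst).mul
    ((hc.stronglyMeasurable_coe (b j)).comp_measurable (measurable_past Z le_rfl)))
    ((hA2.integrable_mul hB2).congr hae), integral_congr_ae hae2, hu,
    hZ.integral_mul_eq_pow hμ (s + t) t n _ (hAm _ le_rfl) hA2,
    ← integral_pairVec_mul_snd b hc (hμ t)]
  refine integral_comp_of_measurePreserving
    (g := fun z => pairVec b z (i, j) * ((koopman (hμ t)) ^ n)
      (toL2 μ (gFun hc (hμ t) b i j)) z.2)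
    (hZ.measurePreserving_pair hμ s t) ?_
  exact ((memLp_pairVec_apply b hc (hμ t) (i, j)).integrable_mul
    ((Lp.memLp _).comp_measurePreserving (measurePreserving_snd (hμ t)))).1

lemma IsMarkovProcess.integral_centeredVec_mul_centeredVec (hZ : IsMarkovProcess ρ μ P Z)
    (hμ : ρ.IsInvariant μ) (hc : Compatible H μ) (s t : ℝ≥0) (n : ℕ) (p : ι × ι) :
    ∫ ω, centeredVec b μ (ρ.ker t) (Z s ω, Z (s + t) ω) p *
        centeredVec b μ (ρ.ker t) (Z (s + t + n * t) ω, Z (s + t + n * t + t) ω) p ∂P =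
      lagTerm hc (hμ t) b n p := by
  obtain ⟨i, j⟩ := p
  set c := ∫ z, pairVec b z (i, j) ∂(μ ⊗ₘ ρ.ker t) with hcdef
  have hmean : (∫ z, pairVec b z ∂(μ ⊗ₘ ρ.ker t) : lp (fun _ : ι × ι => ℝ) 2) (i, j) = c := by
    rw [integral_pairVec_apply b hc (hμ t)]
    simp only [hcdef, pairVec_apply]
  have e : ∀ z, centeredVec b μ (ρ.ker t) z (i, j) = pairVec b z (i, j) - c := fun z => by
    rw [centeredVec, lp.coeFn_sub, Pi.sub_apply, hmean]
  have hF := memLp_pairVec_apply b hc (hμ t) (i, j)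
  have hmp := hZ.measurePreserving_pair hμ
  have hF1 := hF.comp_measurePreserving (hmp s t)
  have hF2 := hF.comp_measurePreserving (hmp (s + t + n * t) t)
  have hm1 := integral_comp_of_measurePreserving (hmp s t) hF.1
  have hm2 := integral_comp_of_measurePreserving (hmp (s + t + n * t) t) hF.1
  have hI := hZ.integral_pairVec_mul_pairVec b hμ hc s t n i j
  simp only [e, sub_mul, mul_sub]
  rw [integral_sub, integral_sub, integral_sub]
  -- Centering subtracts `c * c`. Both $g_{ij}$ and $g^*_{ji}$ have mean `c`, so this is exactly
  -- what the projections `Q` remove.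
  · rw [hI, integral_mul_const, hm1, integral_const_mul, hm2, lagTerm, inner_koopman0_pow,
      inner_gStarFun_oneL2, inner_oneL2_gFun]
    simp [← hcdef]
  · exact (hF1.integrable one_le_two).mul_const c
  · exact integrable_const _
  · exact hF1.integrable_mul hF2
  · exact (hF2.integrable one_le_two).const_mul c
  · exact (hF1.integrable_mul hF2).sub ((hF2.integrable one_le_two).const_mul c)
  · exact ((hF1.integrable one_le_two).mul_const c).sub (integrable_const _)

lemma IsMarkovProcess.measureReal_average_le [Countable ι] (hZ : IsMarkovProcess ρ μ P Z)
    (hμ : ρ.IsInvariant μ) (hc : Compatible H μ) (t : ℝ≥0) {m : ℕ} (hm : 1 ≤ m) {ε : ℝ}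
    (hε : 0 < ε) :
    P.real {ω | ε < ‖(m : ℝ)⁻¹ • ∑ k : Fin m, centeredVec b μ (ρ.ker t)
      (Z ((k : ℕ) * t) ω, Z (((k : ℕ) + 1) * t) ω)‖} ≤
      sigmaSq hc (hμ t) b m / (m * ε ^ 2) := by
  have hm' : (0 : ℝ) < m := by exact_mod_cast hm
  have hζ := memLp_centeredVec b hc (hμ t)
  set ξ : ℕ → Ω → lp (fun _ : ι × ι => ℝ) 2 := fun k ω =>
    centeredVec b μ (ρ.ker t) (Z (k * t) ω, Z ((k + 1) * t) ω) with hξ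
  have hmp : ∀ k : ℕ, MeasurePreserving (fun ω => (Z (k * t) ω, Z ((k + 1) * t) ω)) P
      (μ ⊗ₘ ρ.ker t) := fun k => by
    rw [add_mul, one_mul]
    exact hZ.measurePreserving_pair hμ _ t
  have hξ2 : ∀ k, MemLp (ξ k) 2 P := fun k => hζ.comp_measurePreserving (hmp k)
  have hdiag : ∀ k, ∫ ω, inner ℝ (ξ k ω) (ξ k ω) ∂P = E0 hc (hμ t) := fun k => by
    simp only [real_inner_self_eq_norm_sq]
    rw [← integral_norm_centeredVec_sq b hc (hμ t)]
    exact integral_comp_of_measurePreserving (hmp k) (hζ.1.norm.pow 2)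
  have hlag : ∀ k n, ∫ ω, inner ℝ (ξ k ω) (ξ (k + 1 + n) ω) ∂P =
      ∑' p, lagTerm hc (hμ t) b n p := fun k n => by
    rw [← (hasSum_integral_mul (hξ2 k) (hξ2 (k + 1 + n))).tsum_eq]
    refine tsum_congr fun p => ?_
    rw [← hZ.integral_centeredVec_mul_centeredVec b hμ hc (k * t) t n p]
    have e1 : ((k : ℝ≥0) + 1) * t = k * t + t := by ring
    have e2 : ((k + 1 + n : ℕ) : ℝ≥0) * t = k * t + t + n * t := by push_cast; ring
    have e3 : (((k + 1 + n : ℕ) : ℝ≥0) + 1) * t = k * t + t + n * t + t := by push_cast; ring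
    simp only [hξ, e1, e2, e3]
  have hsum := sum_range_sum_range_eq (fun k l => ∫ ω, inner ℝ (ξ k ω) (ξ l ω) ∂P) _ _ hdiag
    (fun k l => by simp only [real_inner_comm]) hlag m
  have hcheb := measureReal_norm_average_le hm (fun k : Fin m => hξ2 k) hε
  refine hcheb.trans (le_of_eq ?_)
  simp only [Finset.sum_range] at hsum
  -- The double sum equals $m\sigma_m^2$, so dividing by $(m\varepsilon)^2$ leaves a single `m`.
  rw [hsum, sigmaSq, tsum_varTerm, Finset.sum_range]
  field_simp

end SlidingWindow

end KoopmanRKHS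

end

theorem proposition3p3 {d : ℕ} (𝒳 : Set (EuclideanSpace ℝ (Fin d)))
    {H : Type*} [NormedAddCommGroup H] [InnerProductSpace ℝ H] [CompleteSpace H] [RKHS ℝ H 𝒳 ℝ]
    (μ : Measure 𝒳) [IsProbabilityMeasure μ]
    (ρ : TransitionSemigroup 𝒳) (hμ : ρ.IsInvariant μ) (hc : Compatible H μ)
    (t : ℝ≥0) (ht : 0 < t)
    {Ω : Type*} [MeasurableSpace Ω] (P : Measure Ω) [IsProbabilityMeasure P]
    (m : ℕ) (hm : 1 ≤ m) (ε : ℝ) (hε : 0 < ε) :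
    -- the cross-covariance operator is Hilbert-Schmidt
    hsNorm (crossCov hc (hμ t)) ≠ ∞ ∧
    -- case (2): sliding window along one ergodic trajectory
    (ρ.IsErgodic μ → (1 : ℝ) ∈ resolventSet ℝ (koopman0 (hμ t)) →
      ∀ {ι : Type*} (e : HilbertBasis ι ℝ (Lp ℝ 2 μ)) (lam : ι → ℝ) (f : ι → H),
      IsMercerBasis hc e lam f →
      (∀ i j, MemLp (gFun hc (hμ t) f i j) 2 μ) ∧
      (∀ i j, MemLp (gStarFun hc (hμ t) f j i) 2 μ) ∧
      Summable (varTerm hc (hμ t) f m) ∧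
      ∀ Z : ℝ≥0 → Ω → 𝒳, IsMarkovProcess ρ μ P Z →
        P.real {ω | ENNReal.ofReal ε < hsNorm (crossCov hc (hμ t) -
            empirical H (fun k : Fin m => Z ((k : ℕ) * t) ω)
              (fun k : Fin m => Z (((k : ℕ) + 1) * t) ω))}
          ≤ sigmaSq hc (hμ t) f m / (m * ε ^ 2) ∧
        ∀ ψ : H, ‖ψ‖ = 1 →
          P.real {ω | ε < ‖embed hc (koopman (hμ t) (incl hc ψ)) -
              empirical H (fun k : Fin m => Z ((k : ℕ) * t) ω)
                (fun k : Fin m => Z (((k : ℕ) + 1) * t) ω) ψ‖}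
            ≤ sigmaSq hc (hμ t) f m / (m * ε ^ 2)) ∧
    -- case (1): independent samples
    (∀ x y : Fin m → Ω → 𝒳, IsIIDSample (ρ.ker t) μ P x y →
      (P.real {ω | ENNReal.ofReal ε < hsNorm (crossCov hc (hμ t) -
            empirical H (fun k => x k ω) (fun k => y k ω))}
          ≤ E0 hc (hμ t) / (m * ε ^ 2) ∧
        ∀ ψ : H, ‖ψ‖ = 1 →
          P.real {ω | ε < ‖embed hc (koopman (hμ t) (incl hc ψ)) -
              empirical H (fun k => x k ω) (fun k => y k ω) ψ‖}
            ≤ E0 hc (hμ t) / (m * ε ^ 2)) ∧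
      (IsBoundedKernel H →
        P.real {ω | ENNReal.ofReal ε < hsNorm (crossCov hc (hμ t) -
            empirical H (fun k => x k ω) (fun k => y k ω))}
          ≤ 2 * Real.exp (-(m * ε ^ 2 / (8 * kernelSup H ^ 2))) ∧
        ∀ ψ : H, ‖ψ‖ = 1 →
          P.real {ω | ε < ‖embed hc (koopman (hμ t) (incl hc ψ)) -
              empirical H (fun k => x k ω) (fun k => y k ω) ψ‖}
            ≤ 2 * Real.exp (-(m * ε ^ 2 / (8 * kernelSup H ^ 2))))) := by
  have hdev := fun {B : ℝ} (x y : Fin m → Ω → 𝒳) (hB : P.real {ω | ε < ‖(m : ℝ)⁻¹ •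
      ∑ k, centeredVec (someBasis H) μ (ρ.ker t) (x k ω, y k ω)‖} ≤ B) =>
    measureReal_deviation_le (someBasis H) hc (hμ t) hm x y hε hB
  refine ⟨?_, ?_, fun x y hs => ⟨hdev x y (hs.measureReal_average_le _ hc (hμ t) hm hε),
    fun hk => hdev x y (hs.measureReal_average_le_exp _ hc (hμ t) hm hk hε)⟩⟩
  · rw [hsNorm_crossCov (someBasis H)]
    exact enorm_ne_top
  · intro _ _ ι e lam f hB
    have := hc.separableSpace
    -- Matrices are taken in the Mercer basis itself, so that their entries yield the prescribed `g`
    -- and `g*`; elsewhere any basis serves.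
    obtain ⟨b, rfl⟩ := hB.exists_hilbertBasis
    have := countable_of_orthonormal b.orthonormal
    exact ⟨memLp_gFun b hc (hμ t), memLp_gStarFun b hc (hμ t), summable_varTerm b hc (hμ t) m,
      fun Z hZ => measureReal_deviation_le b hc (hμ t) hm
        (fun k ω => Z ((k : ℕ) * t) ω) (fun k ω => Z (((k : ℕ) + 1) * t) ω) hε
        (hZ.measureReal_average_le b hμ hc t hm hε)⟩
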